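/- Let $N\ge 2$, let $d\gamma_N=(2\pi)^{-N/2}e^{-|x|^2/2}\,dx$ be the standard Gaussian measure on $\mathbb R^N$, and for an open set $\Omega\subset\mathbb R^N$ let $H^1(\Omega,d\gamma_N)$ be the space of real functions $u\in W^{1,1}_{\rm loc}(\Omega)$ with $u,|Du|\in L^2(\Omega,d\gamma_N)$, endowed with the norm $\|u\|_{H^1(\Omega,d\gamma_N)}=\|u\|_{L^2(\Omega,d\gamma_N)}+\|Du\|_{L^2(\Omega,d\gamma_N)}$. Say that $\partial\Omega$ satisfies the uniform interior sphere condition with radius $\bar r>0$ if for every $x\in\partial\Omega$ there is an open ball $B_{\bar r}\subset\Omega$ of radius $\bar r$ such that $\overline{B_{\bar r}}\cap\partial\Omega=\{x\}$. **Theorem.** For every $N\ge 2$ and $\bar r>0$ there is a constant $C=C(\bar r,N)$, and for every $d_0\ge 0$ a constant $C'=C'(\bar r,N,d_0)$, such that the following holds. Let $\Omega\subset\mathbb R^N$ be a convex $C^2$ domain (nonempty, open, connected) whose boundary satisfies the uniform interior sphere condition with radius $\bar r$, and let $u\in H^1(\Omega,d\gamma_N)$. 1. If $0\in\Omega$, there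 is $\tilde u\in H^1(\mathbb R^N,d\gamma_N)$ with $\tilde u=u$ in $\Omega$ and $\|\tilde u\|_{H^1(\mathbb R^N,d\gamma_N)}\le C\,\|u\|_{H^1(\Omega,d\gamma_N)}$. 2. If $0\notin\Omega$ and $\mathrm{dist}(0,\partial\Omega)=d_0$, there is $\tilde u\in H^1(\mathbb R^N,d\gamma_N)$ with $\tilde u=u$ in $\Omega$ and $\|\tilde u\|_{H^1(\mathbb R^N,d\gamma_N)}\le C'\,\|u\|_{H^1(\Omega,d\gamma_N)}$. -/

import Mathlib

open MeasureTheory Set Metric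
open scoped ContDiff

namespace GaussExt

noncomputable section

/-- The standard Gaussian measure `(2π)^(-N/2) exp(-|x|²/2) dx` on `ℝ^N`. -/
def gaussianMeasure (N : ℕ) : Measure (EuclideanSpace ℝ (Fin N)) :=
  (volume : Measure (EuclideanSpace ℝ (Fin N))).withDensity fun x =>
    ENNReal.ofReal (1 / (2 * Real.pi) ^ ((N : ℝ) / 2) * Real.exp (-‖x‖ ^ 2 / 2))

/-- `u ∈ W^{1,1}_loc(Ω)` and `g` is its weak gradient on `Ω`: both are locally integrable on `Ω`
for the Lebesgue measure, and `∫_Ω u ∂_v φ = - ∫_Ω φ ⟨g, v⟩` for every direction `v` and every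
test function `φ ∈ C_c^∞(Ω)`. -/
structure HasWeakGradient {N : ℕ} (Ω : Set (EuclideanSpace ℝ (Fin N)))
    (u : EuclideanSpace ℝ (Fin N) → ℝ)
    (g : EuclideanSpace ℝ (Fin N) → EuclideanSpace ℝ (Fin N)) : Prop where
  locallyIntegrableOn : LocallyIntegrableOn u Ω volume
  locallyIntegrableOn_grad : LocallyIntegrableOn g Ω volume
  integral_eq : ∀ φ : EuclideanSpace ℝ (Fin N) → ℝ, ContDiff ℝ ∞ φ → HasCompactSupport φ →
    tsupport φ ⊆ Ω → ∀ v : EuclideanSpace ℝ (Fin N),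
      ∫ x in Ω, u x * fderiv ℝ φ x v = -∫ x in Ω, φ x * inner ℝ (g x) v

open Classical in
/-- The weak gradient `Du` on `Ω` (unique almost everywhere on an open `Ω`, see
`HasWeakGradient.ae_eq`); zero if `u ∉ W^{1,1}_loc(Ω)`. -/
def weakGradient {N : ℕ} (Ω : Set (EuclideanSpace ℝ (Fin N)))
    (u : EuclideanSpace ℝ (Fin N) → ℝ) :
    EuclideanSpace ℝ (Fin N) → EuclideanSpace ℝ (Fin N) :=
  if h : ∃ g, HasWeakGradient Ω u g then h.choose else 0

/-- `u ∈ H¹(Ω, dγ_N)`: `u ∈ W^{1,1}_loc(Ω)`, and `u` and `|Du|` lie in `L²(Ω, dγ_N)`. -/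
def MemH1 {N : ℕ} (Ω : Set (EuclideanSpace ℝ (Fin N)))
    (u : EuclideanSpace ℝ (Fin N) → ℝ) : Prop :=
  (∃ g, HasWeakGradient Ω u g) ∧
    MemLp u 2 ((gaussianMeasure N).restrict Ω) ∧
    MemLp (weakGradient Ω u) 2 ((gaussianMeasure N).restrict Ω)

/-- `‖u‖_{H¹(Ω, dγ_N)} = ‖u‖_{L²(Ω, dγ_N)} + ‖Du‖_{L²(Ω, dγ_N)}`, for `u ∈ H¹(Ω, dγ_N)`. -/
def h1Norm {N : ℕ} (Ω : Set (EuclideanSpace ℝ (Fin N)))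
    (u : EuclideanSpace ℝ (Fin N) → ℝ) : ℝ :=
  (eLpNorm u 2 ((gaussianMeasure N).restrict Ω)).toReal +
    (eLpNorm (weakGradient Ω u) 2 ((gaussianMeasure N).restrict Ω)).toReal

/-- A `C²` domain: a nonempty connected open set that near each of its boundary points is
`{ρ < 0}` for a `C²` function `ρ` with nonvanishing derivative. -/
structure IsC2Domain {N : ℕ} (Ω : Set (EuclideanSpace ℝ (Fin N))) : Prop where
  isOpen : IsOpen Ω
  isConnected : IsConnected Ω
  exists_defining : ∀ x ∈ frontier Ω, ∃ U : Set (EuclideanSpace ℝ (Fin N)), IsOpen U ∧ x ∈ U ∧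
    ∃ ρ : EuclideanSpace ℝ (Fin N) → ℝ, ContDiffOn ℝ 2 ρ U ∧ (∀ y ∈ U, fderiv ℝ ρ y ≠ 0) ∧
      Ω ∩ U = {y ∈ U | ρ y < 0}

/-- The boundary of `Ω` satisfies the uniform interior sphere condition with radius `r`: each
boundary point is the only boundary point on the closure of some ball of radius `r` contained
in `Ω`. -/
def InteriorSphereCondition {N : ℕ} (Ω : Set (EuclideanSpace ℝ (Fin N))) (r : ℝ) : Prop :=
  ∀ x ∈ frontier Ω, ∃ c : EuclideanSpace ℝ (Fin N),
    ball c r ⊆ Ω ∧ closure (ball c r) ∩ frontier Ω = {x}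

/-- Weak gradients on an open set are unique almost everywhere. -/
theorem HasWeakGradient.ae_eq {N : ℕ} {Ω : Set (EuclideanSpace ℝ (Fin N))} (hΩ : IsOpen Ω)
    {u : EuclideanSpace ℝ (Fin N) → ℝ}
    {g g' : EuclideanSpace ℝ (Fin N) → EuclideanSpace ℝ (Fin N)}
    (h : HasWeakGradient Ω u g) (h' : HasWeakGradient Ω u g') :
    g =ᵐ[volume.restrict Ω] g' := by
  have key : ∀ᵐ x, x ∈ Ω → (g - g') x = 0 := by
    refine hΩ.ae_eq_zero_of_integral_contDiff_smul_eq_zero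
      (h.locallyIntegrableOn_grad.sub h'.locallyIntegrableOn_grad) ?_
    intro φ hφ hc hs
    have hint : ∀ {f : EuclideanSpace ℝ (Fin N) → EuclideanSpace ℝ (Fin N)},
        LocallyIntegrableOn f Ω volume → Integrable (fun x => φ x • f x) (volume.restrict Ω) := by
      intro f hf
      have h1 : IntegrableOn f (tsupport φ) volume :=
        hf.integrableOn_compact_subset hs hc
      have h2 : IntegrableOn (fun x => φ x • f x) (tsupport φ) volume :=
        IntegrableOn.continuousOn_smul h1 hφ.continuous.continuousOn hc
      have h3 : Integrable (fun x => φ x • f x) volume := by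
        rw [← integrableOn_iff_integrable_of_support_subset (s := tsupport φ)]
        · exact h2
        · intro x hx
          apply subset_tsupport
          intro h0
          simp [h0] at hx
      exact h3.integrableOn
    have e1 : ∫ x, φ x • (g - g') x = ∫ x in Ω, φ x • (g - g') x := by
      symm
      apply setIntegral_eq_integral_of_forall_compl_eq_zero
      intro x hx
      have : φ x = 0 := by
        by_contra h0
        exact hx (hs (subset_tsupport _ h0))
      simp [this]
    rw [e1]
    have e2 : ∫ x in Ω, φ x • (g - g') x = ∫ x in Ω, (φ x • g x - φ x • g' x) := by
      simp [smul_sub]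
    have hg := hint h.locallyIntegrableOn_grad
    have hg' := hint h'.locallyIntegrableOn_grad
    rw [e2, integral_sub hg hg', sub_eq_zero]
    refine ext_inner_left ℝ fun v => ?_
    have a := h.integral_eq φ hφ hc hs v
    have b := h'.integral_eq φ hφ hc hs v
    rw [← integral_inner hg v, ← integral_inner hg' v]
    simp only [inner_smul_right]
    simp only [real_inner_comm v] at a b
    linarith
  rw [Filter.EventuallyEq, ae_restrict_iff' hΩ.measurableSet]
  filter_upwards [key] with x hx hxΩ
  exact sub_eq_zero.1 (hx hxΩ)

/-- The chosen weak gradient agrees almost everywhere with any other one. -/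
theorem HasWeakGradient.weakGradient_ae_eq {N : ℕ} {Ω : Set (EuclideanSpace ℝ (Fin N))}
    (hΩ : IsOpen Ω) {u : EuclideanSpace ℝ (Fin N) → ℝ}
    {g : EuclideanSpace ℝ (Fin N) → EuclideanSpace ℝ (Fin N)} (h : HasWeakGradient Ω u g) :
    weakGradient Ω u =ᵐ[volume.restrict Ω] g := by
  have hex : ∃ g, HasWeakGradient Ω u g := ⟨g, h⟩
  rw [weakGradient, dif_pos hex]
  exact hex.choose_spec.ae_eq hΩ h

end

end GaussExt

/-!
# Extension operators for Gaussian Sobolev spaces on convex domains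

A convex domain `Ω` with the uniform interior sphere condition of radius `r` is the open
`r`-neighbourhood of the closed convex set `K = core Ω r` of the centres of its interior balls
(`InteriorSphereCondition.mem_iff`). The metric projection on `K` therefore gives global coordinates
`x = k + s n`, with `k ∈ K`, `n` a unit normal at `k` and `s` the distance from `K`, and the
reflection `k + s n ↦ k + (2 r - s) n` across `∂Ω` is Lipschitz, with a Lipschitz inverse on
`r ≤ s ≤ 3 r / 2`, because the projection is firmly nonexpansive. With `F` equal to this reflection
outside `Ω` and to the identity in `Ω`, and with a cutoff `η` in the variable `s`, the extension of `u`
is `η * (u ∘ F)`.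

Two facts bound it. Since `F` has a Lipschitz inverse on the collar, it does not concentrate
Lebesgue measure by more than a constant factor (`map_reflection_le`). For the weights, a point `x` at
distance `τ` from the boundary point `z` satisfies `‖x‖² - ‖F x‖² = 4 τ ⟪z, n⟫`, and by convexity
`⟪z, n⟫ ≥ -‖p‖` for every `p` in the closure of `Ω` (`norm_sq_reflection_le`): the Gaussian density at
`x` is at most `exp (r ‖p‖)` times the density at `F x`. The point `p` is the origin when `0 ∈ Ω`, and a
boundary point nearest to the origin otherwise. Only the interior spheres, not the regularity of the
boundary, enter the estimates.

That `η * (u ∘ F)` has a weak gradient, given by the chain rule, on the whole space is clear when `u` is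
smooth up to the boundary: the extension is then Lipschitz
(`ExtensionData.integral_extFun_of_contDiff`). The general case follows by approximation in
`W^{1,1}` on bounded convex sets (`HasWeakGradient.exists_tendsto`): contracting the set slightly
towards an interior point leaves room to mollify.
-/

namespace GaussExt

noncomputable section

open Filter Topology ContinuousLinearMap
open scoped RealInnerProductSpace NNReal ENNReal Convolution

/-! ### Metric projection onto a closed convex set -/

section Projection

variable {E : Type*} [NormedAddCommGroup E] [InnerProductSpace ℝ E]

/-- The variational inequalities `⟪x - a, b - a⟫ ≤ 0` and `⟪y - b, a - b⟫ ≤ 0` characterize `a`, `b`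
as projections of `x`, `y` on a convex set; they force both `x ↦ a` and `x ↦ x - a` to be
nonexpansive. -/
theorem norm_sq_add_norm_sq_le_of_inner_le_zero {x y a b : E}
    (h₁ : ⟪x - a, b - a⟫ ≤ 0) (h₂ : ⟪y - b, a - b⟫ ≤ 0) :
    ‖a - b‖ ^ 2 + ‖(x - a) - (y - b)‖ ^ 2 ≤ ‖x - y‖ ^ 2 := by
  have e : x - y = (a - b) + ((x - a) - (y - b)) := by abel
  have h : 0 ≤ ⟪a - b, (x - a) - (y - b)⟫ := by
    have : ⟪a - b, (x - a) - (y - b)⟫ = - ⟪x - a, b - a⟫ - ⟪y - b, a - b⟫ := by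
      rw [← neg_sub a b, inner_neg_right, inner_sub_right, real_inner_comm, real_inner_comm (y - b)]
      ring
    linarith
  rw [e, norm_add_sq_real]
  linarith

/-- The radial projection onto the closed ball of radius `ρ` about the origin. -/
def radialProj (ρ : ℝ) (y : E) : E := if ‖y‖ ≤ ρ then y else (ρ / ‖y‖) • y

theorem radialProj_of_le {ρ : ℝ} {y : E} (h : ‖y‖ ≤ ρ) : radialProj ρ y = y := if_pos h

theorem radialProj_of_ge {ρ : ℝ} {y : E} (hρ : 0 < ρ) (h : ρ ≤ ‖y‖) :
    radialProj ρ y = (ρ / ‖y‖) • y := by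
  unfold radialProj
  split_ifs with h'
  · rw [le_antisymm h' h, div_self hρ.ne', one_smul]
  · rfl

theorem norm_radialProj_le {ρ : ℝ} (hρ : 0 < ρ) (y : E) : ‖radialProj ρ y‖ ≤ ρ := by
  rcases le_total ‖y‖ ρ with h | h
  · rwa [radialProj_of_le h]
  · rw [radialProj_of_ge hρ h, norm_smul, Real.norm_of_nonneg (by positivity),
      div_mul_cancel₀ _ (hρ.trans_le h).ne']

theorem inner_radialProj_le_zero {ρ : ℝ} (hρ : 0 < ρ) (y : E) {b : E} (hb : ‖b‖ ≤ ρ) :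
    ⟪y - radialProj ρ y, b - radialProj ρ y⟫ ≤ 0 := by
  rcases le_total ‖y‖ ρ with h | h
  · simp [radialProj_of_le h]
  · have hy : 0 < ‖y‖ := hρ.trans_le h
    rw [radialProj_of_ge hρ h]
    have e : y - (ρ / ‖y‖) • y = (1 - ρ / ‖y‖) • y := by rw [sub_smul, one_smul]
    have h1 : 0 ≤ 1 - ρ / ‖y‖ := by
      rw [sub_nonneg, div_le_one hy]; exact h
    rw [e, real_inner_smul_left, inner_sub_right, real_inner_smul_right,
      real_inner_self_eq_norm_sq]
    refine mul_nonpos_of_nonneg_of_nonpos h1 ?_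
    have h2 := real_inner_le_norm y b
    have h3 : ρ / ‖y‖ * ‖y‖ ^ 2 = ‖y‖ * ρ := by field_simp
    rw [h3]
    nlinarith

theorem lipschitzWith_radialProj {ρ : ℝ} (hρ : 0 < ρ) :
    LipschitzWith 1 (radialProj ρ : E → E) := by
  refine LipschitzWith.of_dist_le_mul fun x y => ?_
  have h := norm_sq_add_norm_sq_le_of_inner_le_zero
    (inner_radialProj_le_zero hρ x (norm_radialProj_le hρ y))
    (inner_radialProj_le_zero hρ y (norm_radialProj_le hρ x))
  rw [NNReal.coe_one, one_mul, dist_eq_norm, dist_eq_norm]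
  exact abs_le_of_sq_le_sq' (by nlinarith [sq_nonneg ‖(x - radialProj ρ x) - (y - radialProj ρ y)‖])
    (norm_nonneg _) |>.2

/-- A nonempty complete convex set: every point has a unique metric projection on it. -/
structure IsProjectable (K : Set E) : Prop where
  nonempty : K.Nonempty
  isComplete : IsComplete K
  convex : Convex ℝ K

theorem IsProjectable.exists_proj {K : Set E} (hK : IsProjectable K) (x : E) :
    ∃ v ∈ K, ∀ w ∈ K, ⟪x - v, w - v⟫ ≤ 0 := by
  obtain ⟨v, hv, h⟩ := exists_norm_eq_iInf_of_complete_convex hK.nonempty hK.isComplete hK.convex x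
  exact ⟨v, hv, (norm_eq_iInf_iff_real_inner_le_zero hK.convex hv).1 h⟩

open Classical in
/-- The metric projection onto `K`; the identity if `K` is not projectable. -/
def metricProj (K : Set E) (x : E) : E :=
  if h : IsProjectable K then (h.exists_proj x).choose else x

/-- The vector from the metric projection of `x` on `K` to `x`; its length is the distance
from `x` to `K`. -/
def residual (K : Set E) (x : E) : E := x - metricProj K x

namespace IsProjectable

variable {K : Set E} (hK : IsProjectable K)
include hK

theorem metricProj_mem (x : E) : metricProj K x ∈ K := by
  rw [metricProj, dif_pos hK]; exact (hK.exists_proj x).choose_spec.1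

theorem inner_residual_le_zero (x : E) {w : E} (hw : w ∈ K) :
    ⟪residual K x, w - metricProj K x⟫ ≤ 0 := by
  rw [residual, metricProj, dif_pos hK]; exact (hK.exists_proj x).choose_spec.2 w hw

theorem lipschitzWith_residual : LipschitzWith 1 (residual K) := by
  refine LipschitzWith.of_dist_le_mul fun x y => ?_
  have h := norm_sq_add_norm_sq_le_of_inner_le_zero
    (hK.inner_residual_le_zero x (hK.metricProj_mem y))
    (hK.inner_residual_le_zero y (hK.metricProj_mem x))
  rw [NNReal.coe_one, one_mul, dist_eq_norm, dist_eq_norm]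
  refine abs_le_of_sq_le_sq' ?_ (norm_nonneg _) |>.2
  have := sq_nonneg ‖metricProj K x - metricProj K y‖
  simp only [residual] at h ⊢
  linarith

theorem metricProj_eq {x v : E} (hv : v ∈ K) (h : ∀ w ∈ K, ⟪x - v, w - v⟫ ≤ 0) :
    metricProj K x = v := by
  have := norm_sq_add_norm_sq_le_of_inner_le_zero
    (hK.inner_residual_le_zero x hv) (h _ (hK.metricProj_mem x))
  rw [sub_self, norm_zero] at this
  have h0 : ‖metricProj K x - v‖ ^ 2 ≤ 0 := by
    nlinarith [sq_nonneg ‖x - metricProj K x - (x - v)‖]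
  rw [← sub_eq_zero, ← norm_eq_zero]
  exact pow_eq_zero_iff (two_ne_zero) |>.1 (le_antisymm h0 (sq_nonneg _))

theorem metricProj_add_smul_residual (x : E) {m : ℝ} (hm : 0 ≤ m) :
    metricProj K (metricProj K x + m • residual K x) = metricProj K x := by
  refine hK.metricProj_eq (hK.metricProj_mem x) fun w hw => ?_
  rw [add_sub_cancel_left, real_inner_smul_left]
  exact mul_nonpos_of_nonneg_of_nonpos hm (hK.inner_residual_le_zero x hw)

theorem residual_add_smul_residual (x : E) {m : ℝ} (hm : 0 ≤ m) :
    residual K (metricProj K x + m • residual K x) = m • residual K x := by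
  rw [residual, hK.metricProj_add_smul_residual x hm, add_sub_cancel_left]

theorem norm_residual_le (x : E) {w : E} (hw : w ∈ K) : ‖residual K x‖ ≤ ‖x - w‖ := by
  have h := hK.inner_residual_le_zero x hw
  have e : x - w = residual K x - (w - metricProj K x) := by rw [residual]; abel
  refine abs_le_of_sq_le_sq' ?_ (norm_nonneg _) |>.2
  rw [e, norm_sub_sq_real]
  nlinarith [sq_nonneg ‖w - metricProj K x‖]

end IsProjectable

theorem metricProj_add_residual (K : Set E) (x : E) : metricProj K x + residual K x = x := by
  rw [residual]; abel

end Projection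

/-! ### The core of a convex domain with the interior sphere condition -/

section Core

/-- The centres of the balls of radius `r` contained in `Ω`. -/
def core {E : Type*} [PseudoMetricSpace E] (Ω : Set E) (r : ℝ) : Set E := {c | ball c r ⊆ Ω}

theorem isClosed_core {E : Type*} [PseudoMetricSpace E] (Ω : Set E) (r : ℝ) : IsClosed (core Ω r) := by
  rw [← isOpen_compl_iff, Metric.isOpen_iff]
  intro c hc
  obtain ⟨z, hz, hzΩ⟩ := not_subset.1 hc
  refine ⟨r - dist z c, by simpa using hz, fun c' hc' h => hzΩ (h ?_)⟩
  have := dist_triangle z c c'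
  rw [mem_ball, dist_comm] at hc'
  rw [mem_ball]; linarith

variable {E : Type*} [NormedAddCommGroup E] [InnerProductSpace ℝ E]

theorem convex_core {Ω : Set E} (hΩ : Convex ℝ Ω) (r : ℝ) : Convex ℝ (core Ω r) := by
  intro c hc d hd a b ha hb hab z hz
  have h1 : c + (z - (a • c + b • d)) ∈ Ω := hc (by simpa [dist_eq_norm] using hz)
  have h2 : d + (z - (a • c + b • d)) ∈ Ω := hd (by simpa [dist_eq_norm] using hz)
  have := hΩ h1 h2 ha hb hab
  convert this using 1
  have : a • (z - (a • c + b • d)) + b • (z - (a • c + b • d)) = z - (a • c + b • d) := by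
    rw [← add_smul, hab, one_smul]
  rw [smul_add, smul_add, add_add_add_comm, this]
  abel

/-- A ball of radius `r` in a half-space touching the boundary hyperplane at `z` has its centre at
distance `r` from `z` along the normal. -/
theorem eq_sub_smul_of_ball_subset_halfSpace {c z ν : E} {r : ℝ} (hr : 0 < r) (hν : ‖ν‖ = 1)
    (hz : dist z c ≤ r) (h : ∀ y ∈ ball c r, ⟪y - z, ν⟫ ≤ 0) : c = z - r • ν := by
  have h1 : ⟪c - z, ν⟫ ≤ -r := by
    refine le_of_forall_pos_lt_add fun ε hε => ?_
    set δ := min (ε / 2) r with hδ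
    have hδ0 : 0 < δ := lt_min (by linarith) hr
    have hδr : δ ≤ r := min_le_right _ _
    have hδε : δ ≤ ε / 2 := min_le_left _ _
    have := h (c + (r - δ) • ν) (by
      rw [mem_ball, dist_eq_norm, add_sub_cancel_left, norm_smul, hν, mul_one, Real.norm_eq_abs,
        abs_of_nonneg (by linarith)]
      linarith)
    have e : c + (r - δ) • ν - z = (c - z) + (r - δ) • ν := by abel
    rw [e, inner_add_left, real_inner_smul_left, real_inner_self_eq_norm_sq, hν] at this
    linarith
  have h2 : ‖(c - z) + r • ν‖ ^ 2 ≤ 0 := by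
    rw [norm_add_sq_real, real_inner_smul_right, norm_smul, hν, Real.norm_of_nonneg hr.le]
    have h3 : ‖c - z‖ ≤ r := by rwa [← dist_eq_norm, dist_comm]
    nlinarith [norm_nonneg (c - z)]
  have h3 : (c - z) + r • ν = 0 := by
    rw [← norm_eq_zero]
    exact pow_eq_zero_iff (two_ne_zero) |>.1 (le_antisymm h2 (sq_nonneg _))
  have : c = ((c - z) + r • ν) + (z - r • ν) := by abel
  rw [this, h3, zero_add]

end Core

section CoreEuclidean

variable {N : ℕ} {Ω : Set (EuclideanSpace ℝ (Fin N))} {r : ℝ}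

/-- Each point of a convex domain with the interior sphere condition lies in a ball of radius `r`
contained in the domain: at the boundary point nearest to it, the interior ball and the
largest ball centred at the given point touch the same supporting hyperplane. -/
theorem InteriorSphereCondition.exists_mem_core (h : InteriorSphereCondition Ω r) (hr : 0 < r)
    (ho : IsOpen Ω) (hc : Convex ℝ Ω) {x : EuclideanSpace ℝ (Fin N)} (hx : x ∈ Ω) :
    ∃ c ∈ core Ω r, dist x c < r := by
  by_cases hxc : ball x r ⊆ Ω
  · exact ⟨x, hxc, by simpa⟩
  obtain ⟨y, hy, hyΩ⟩ := not_subset.1 hxc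
  obtain ⟨z, hz, hzd⟩ := (isClosed_compl_iff.2 ho).exists_infDist_eq_dist ⟨y, hyΩ⟩ x
  set δ := dist x z with hδ
  have hball : ball x δ ⊆ Ω := by
    intro w hw
    by_contra hw'
    have := infDist_le_dist_of_mem (x := x) (show w ∈ Ωᶜ from hw')
    rw [mem_ball, dist_comm] at hw
    linarith
  have hδ0 : 0 < δ := dist_pos.2 fun e => hz (e ▸ hx)
  have hδr : δ < r := by
    have := infDist_le_dist_of_mem (x := x) (show y ∈ Ωᶜ from hyΩ)
    rw [mem_ball, dist_comm] at hy
    linarith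
  have hzc : z ∈ closure Ω := by
    refine closure_mono hball ?_
    rw [closure_ball x hδ0.ne', mem_closedBall, dist_comm]
  have hzf : z ∈ frontier Ω := by
    rw [ho.frontier_eq]; exact ⟨hzc, hz⟩
  obtain ⟨c, hcΩ, hcz⟩ := h z hzf
  have hzc' : dist z c ≤ r := by
    have : z ∈ closure (ball c r) := (hcz ▸ mem_singleton z : z ∈ closure (ball c r) ∩ frontier Ω).1
    exact closure_ball_subset_closedBall this
  obtain ⟨f, hf⟩ := geometric_hahn_banach_open_point hc ho hz
  set a := (InnerProductSpace.toDual ℝ (EuclideanSpace ℝ (Fin N))).symm f with ha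
  have hfa : ∀ w, f w = ⟪w, a⟫ := fun w => by
    rw [real_inner_comm, ha, InnerProductSpace.toDual_symm_apply]
  have ha0 : a ≠ 0 := by
    intro h0
    have := hf x hx
    rw [hfa, hfa, h0] at this
    simp at this
  have hν : ‖(‖a‖⁻¹ • a)‖ = 1 := by
    rw [norm_smul, norm_inv, norm_norm, inv_mul_cancel₀ (norm_ne_zero_iff.2 ha0)]
  have hside : ∀ w ∈ Ω, ⟪w - z, ‖a‖⁻¹ • a⟫ ≤ 0 := by
    intro w hw
    rw [real_inner_smul_right, inner_sub_left, ← hfa, ← hfa]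
    exact mul_nonpos_of_nonneg_of_nonpos (by positivity) (by linarith [hf w hw])
  have e1 := eq_sub_smul_of_ball_subset_halfSpace hr hν hzc' fun w hw => hside w (hcΩ hw)
  have e2 := eq_sub_smul_of_ball_subset_halfSpace hδ0 hν (dist_comm z x).le
    fun w hw => hside w (hball hw)
  refine ⟨c, hcΩ, ?_⟩
  have e3 : x - c = (r - δ) • (‖a‖⁻¹ • a) := by
    rw [e1]; nth_rw 1 [e2]; rw [sub_smul]; abel
  rw [dist_eq_norm, e3, norm_smul, hν, mul_one, Real.norm_of_nonneg (by linarith)]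
  linarith

theorem InteriorSphereCondition.isProjectable_core (h : InteriorSphereCondition Ω r) (hr : 0 < r)
    (ho : IsOpen Ω) (hc : Convex ℝ Ω) (hne : Ω.Nonempty) : IsProjectable (core Ω r) := by
  obtain ⟨x, hx⟩ := hne
  obtain ⟨c, hcc, -⟩ := h.exists_mem_core hr ho hc hx
  exact ⟨⟨c, hcc⟩, (isClosed_core Ω r).isComplete, convex_core hc r⟩

/-- The domain is the open `r`-neighbourhood of its core. -/
theorem InteriorSphereCondition.mem_iff (h : InteriorSphereCondition Ω r) (hr : 0 < r)
    (ho : IsOpen Ω) (hc : Convex ℝ Ω) (hne : Ω.Nonempty) (x : EuclideanSpace ℝ (Fin N)) :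
    x ∈ Ω ↔ ‖residual (core Ω r) x‖ < r := by
  have hK := h.isProjectable_core hr ho hc hne
  constructor
  · intro hx
    obtain ⟨c, hcc, hd⟩ := h.exists_mem_core hr ho hc hx
    rw [dist_eq_norm] at hd
    exact (hK.norm_residual_le x hcc).trans_lt hd
  · intro hx
    refine hK.metricProj_mem x ?_
    rwa [mem_ball, dist_eq_norm]

end CoreEuclidean

/-! ### Reflection across the boundary of a neighbourhood of a convex set -/

section Reflection

variable {E : Type*} [NormedAddCommGroup E] [InnerProductSpace ℝ E]

/-- The reflection across the boundary of the `r`-neighbourhood of `K`: it sends `k + s n` to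
`k + (2 r - s) n` for `s ≥ r`, where `k ∈ K` and `n` is a unit normal of `K` at `k`, and fixes the
points at distance at most `r` from `K`. -/
def reflection (K : Set E) (r : ℝ) (x : E) : E :=
  x - (2 : ℝ) • residual K x + (2 : ℝ) • radialProj r (residual K x)

/-- The inverse of `reflection K r` on the points at distance between `r` and `3 r / 2` from `K`. -/
def reflectionInv (K : Set E) (r : ℝ) (y : E) : E :=
  y - (2 : ℝ) • residual K y + (4 : ℝ) • radialProj (r / 2) (residual K y)

/-- The cutoff equal to `1` at distance at most `r` from `K` and to `0` at distance at least
`3 r / 2`. -/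
def cutoff (K : Set E) (r : ℝ) (x : E) : ℝ := max 0 (min 1 (3 - 2 / r * ‖residual K x‖))

variable {K : Set E} {r : ℝ}

theorem reflection_of_le {x : E} (hx : ‖residual K x‖ ≤ r) : reflection K r x = x := by
  rw [reflection, radialProj_of_le hx, sub_add_cancel]

theorem reflection_of_ge (hr : 0 < r) {x : E} (hx : r ≤ ‖residual K x‖) :
    reflection K r x = metricProj K x + (2 * r / ‖residual K x‖ - 1) • residual K x := by
  rw [reflection, radialProj_of_ge hr hx]
  nth_rw 1 [← metricProj_add_residual K x]
  rw [sub_smul, smul_smul, mul_div_assoc, two_smul, one_smul]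
  abel

variable (hK : IsProjectable K)
include hK

theorem lipschitzWith_reflection (hr : 0 < r) : LipschitzWith 5 (reflection K r) := by
  have h1 := (LipschitzWith.id (α := E)).sub
    ((lipschitzWith_smul (2 : ℝ)).comp hK.lipschitzWith_residual)
  have h2 := h1.add ((lipschitzWith_smul (2 : ℝ)).comp
    ((lipschitzWith_radialProj hr).comp hK.lipschitzWith_residual))
  refine h2.weaken ?_
  simp only [Real.nnnorm_ofNat, mul_one]
  norm_num

theorem lipschitzWith_reflectionInv (hr : 0 < r) : LipschitzWith 7 (reflectionInv K r) := by
  have h1 := (LipschitzWith.id (α := E)).sub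
    ((lipschitzWith_smul (2 : ℝ)).comp hK.lipschitzWith_residual)
  have h2 := h1.add ((lipschitzWith_smul (4 : ℝ)).comp
    ((lipschitzWith_radialProj (half_pos hr)).comp hK.lipschitzWith_residual))
  refine h2.weaken ?_
  simp only [Real.nnnorm_ofNat, mul_one]
  norm_num

theorem residual_reflection (hr : 0 < r) {x : E} (h₁ : r ≤ ‖residual K x‖)
    (h₂ : ‖residual K x‖ ≤ 3 * r / 2) :
    residual K (reflection K r x) = (2 * r / ‖residual K x‖ - 1) • residual K x ∧
      ‖residual K (reflection K r x)‖ = 2 * r - ‖residual K x‖ := by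
  have h0 : 0 < ‖residual K x‖ := hr.trans_le h₁
  have hm : 0 ≤ 2 * r / ‖residual K x‖ - 1 := by
    rw [sub_nonneg, le_div_iff₀ h0]; linarith
  have e := hK.residual_add_smul_residual x hm
  rw [← reflection_of_ge hr h₁] at e
  refine ⟨e, ?_⟩
  rw [e, norm_smul, Real.norm_of_nonneg hm]
  field_simp

theorem reflectionInv_reflection (hr : 0 < r) {x : E} (h₁ : r ≤ ‖residual K x‖)
    (h₂ : ‖residual K x‖ ≤ 3 * r / 2) : reflectionInv K r (reflection K r x) = x := by
  obtain ⟨e1, e2⟩ := residual_reflection hK hr h₁ h₂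
  have h0 : 0 < ‖residual K x‖ := hr.trans_le h₁
  have h3 : 0 < 2 * r - ‖residual K x‖ := by linarith
  rw [reflectionInv, radialProj_of_ge (half_pos hr) (by rw [e2]; linarith), e2, e1,
    reflection_of_ge hr h₁]
  rw [smul_smul, smul_smul, smul_smul, add_sub_assoc, ← sub_smul, add_assoc, ← add_smul]
  refine Eq.trans ?_ (metricProj_add_residual K x)
  congr 1
  refine Eq.trans ?_ (one_smul ℝ (residual K x))
  congr 1
  field_simp
  ring

/-- The reflection decreases the norm up to a constant, since the boundary point `z` between `x` and
its reflection satisfies `⟪z, n⟫ ≥ ⟪p, n⟫ ≥ -‖p‖` for the outward normal `n` at `z`. -/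
theorem norm_sq_reflection_le (hr : 0 < r) {p : E} (hp : ‖residual K p‖ ≤ r) {x : E}
    (h₂ : ‖residual K x‖ ≤ 3 * r / 2) :
    ‖reflection K r x‖ ^ 2 ≤ ‖x‖ ^ 2 + 2 * r * ‖p‖ := by
  rcases le_total ‖residual K x‖ r with h | h₁
  · rw [reflection_of_le h]
    have := norm_nonneg p
    have : 0 ≤ 2 * r * ‖p‖ := by positivity
    linarith
  have h0 : 0 < ‖residual K x‖ := hr.trans_le h₁
  set s := ‖residual K x‖ with hs
  set q := residual K x with hq
  set k := metricProj K x with hk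
  have ex : x = k + q := (metricProj_add_residual K x).symm
  -- the inequality `⟪p - z, n⟫ ≤ 0`, with `n = q / s` and `z = k + r n`
  have hpz : ⟪p, q⟫ ≤ ⟪k, q⟫ + r * s := by
    have e : p = metricProj K p + residual K p := (metricProj_add_residual K p).symm
    have a1 := hK.inner_residual_le_zero x (hK.metricProj_mem p)
    have a2 := real_inner_le_norm (residual K p) q
    rw [← hq, ← hk, inner_sub_right, real_inner_comm, real_inner_comm k] at a1
    rw [e, inner_add_left]
    nlinarith
  have hpn := (abs_le.1 (abs_real_inner_le_norm p q)).1
  rw [reflection_of_ge hr h₁, ← hk, ← hq, ← hs]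
  have exn : ‖x‖ ^ 2 = ‖k‖ ^ 2 + 2 * ⟪k, q⟫ + s ^ 2 := by rw [ex, norm_add_sq_real]
  rw [exn, norm_add_sq_real, real_inner_smul_right, norm_smul, mul_pow, ← hs,
    Real.norm_eq_abs, sq_abs]
  have hkq : -(‖p‖ * s) - r * s ≤ ⟪k, q⟫ := by rw [← hs] at hpn; linarith
  have e1 : (2 * r / s - 1) ^ 2 * s ^ 2 = (2 * r - s) ^ 2 := by field_simp
  have e2 : 2 * ((2 * r / s - 1) * ⟪k, q⟫) = 2 * ⟪k, q⟫ - 4 * ((s - r) / s) * ⟪k, q⟫ := by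
    field_simp; ring
  have hc0 : 0 ≤ (s - r) / s := div_nonneg (by linarith) h0.le
  have e3 := mul_le_mul_of_nonneg_left hkq hc0
  have e4 : (s - r) / s * (-(‖p‖ * s) - r * s) = -(s - r) * (‖p‖ + r) := by
    field_simp; ring
  rw [e4] at e3
  rw [e1, e2]
  have := norm_nonneg p
  nlinarith

theorem lipschitzWith_cutoff (hr : 0 < r) : LipschitzWith (Real.toNNReal (2 / r)) (cutoff K r) := by
  refine LipschitzWith.const_max (LipschitzWith.const_min ?_ 1) 0
  refine LipschitzWith.of_dist_le_mul fun x y => ?_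
  have h := hK.lipschitzWith_residual.dist_le_mul x y
  have h' := abs_norm_sub_norm_le (residual K x) (residual K y)
  rw [NNReal.coe_one, one_mul, dist_eq_norm] at h
  rw [Real.coe_toNNReal _ (by positivity), Real.dist_eq,
    show 3 - 2 / r * ‖residual K x‖ - (3 - 2 / r * ‖residual K y‖)
      = - (2 / r * (‖residual K x‖ - ‖residual K y‖)) by ring, abs_neg, abs_mul,
    abs_of_nonneg (by positivity : 0 ≤ 2 / r)]
  exact mul_le_mul_of_nonneg_left (h'.trans h) (by positivity)

omit hK

theorem cutoff_nonneg (x : E) : 0 ≤ cutoff K r x := le_max_left _ _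

theorem cutoff_le_one (x : E) : cutoff K r x ≤ 1 :=
  max_le zero_le_one (min_le_left _ _)

theorem cutoff_eq_one (hr : 0 < r) {x : E} (hx : ‖residual K x‖ ≤ r) : cutoff K r x = 1 := by
  have : 2 / r * ‖residual K x‖ ≤ 2 := by
    rw [div_mul_eq_mul_div, div_le_iff₀ hr]; linarith
  rw [cutoff, min_eq_left (by linarith), max_eq_right zero_le_one]

theorem cutoff_eq_zero (hr : 0 < r) {x : E} (hx : 3 * r / 2 ≤ ‖residual K x‖) :
    cutoff K r x = 0 := by
  have : 3 ≤ 2 / r * ‖residual K x‖ := by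
    rw [div_mul_eq_mul_div, le_div_iff₀ hr]; linarith
  exact max_eq_left ((min_le_right _ _).trans (by linarith))

end Reflection

/-! ### Mollification combined with a contraction towards an interior point -/

section Affine

variable {E : Type*} [NormedAddCommGroup E] [NormedSpace ℝ E] [FiniteDimensional ℝ E]
  [MeasurableSpace E] [BorelSpace E] {μ : Measure E} [μ.IsAddHaarMeasure]
  {V : Type*} [NormedAddCommGroup V]

theorem integrable_comp_affine {f : E → V} (hf : Integrable f μ) {c : ℝ} (hc : c ≠ 0) (b : E) :
    Integrable (fun x => f (c • x + b)) μ :=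
  (hf.comp_add_right b).comp_smul hc

theorem integral_norm_comp_affine_le (f : E → V) {c : ℝ} (hc : 1 / 2 ≤ c) (b : E) :
    ∫ x, ‖f (c • x + b)‖ ∂μ ≤ 2 ^ Module.finrank ℝ E * ∫ x, ‖f x‖ ∂μ := by
  have h1 := Measure.integral_comp_smul μ (fun x : E => ‖f (x + b)‖) c
  have hc0 : 0 < c := by linarith
  rw [h1, integral_add_right_eq_self (fun x => ‖f x‖) b, smul_eq_mul, abs_of_pos (by positivity),
    ← inv_pow]
  refine mul_le_mul_of_nonneg_right (pow_le_pow_left₀ (by positivity) ?_ _)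
    (integral_nonneg fun _ => norm_nonneg _)
  rw [inv_le_comm₀ hc0 two_pos]
  linarith

end Affine

section Mollify

variable {E : Type*} [NormedAddCommGroup E] [InnerProductSpace ℝ E] [FiniteDimensional ℝ E]
  [MeasurableSpace E] [BorelSpace E]
  {V : Type*} [NormedAddCommGroup V] [NormedSpace ℝ V]

/-- The mollification of `f` by the bump function `φ`, evaluated at the image of `x` under the
contraction of ratio `1 - t` towards `p`. -/
def mollify (φ : ContDiffBump (0 : E)) (t : ℝ) (p : E) (f : E → V) (x : E) : V :=
  (φ.normed volume ⋆[lsmul ℝ ℝ, volume] f) ((1 - t) • x + t • p)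

theorem integrable_mollify (φ : ContDiffBump (0 : E)) {t : ℝ} (ht : t ≤ 1 / 2) (p : E) {f : E → V}
    (hf : Integrable f) : Integrable (mollify φ t p f) :=
  integrable_comp_affine (φ.integrable_normed.integrable_convolution (lsmul ℝ ℝ) hf)
    (by linarith) _

theorem mollify_sub (φ : ContDiffBump (0 : E)) (t : ℝ) (p : E) {f h : E → V}
    (hf : LocallyIntegrable f) (hh : LocallyIntegrable h) (x : E) :
    mollify φ t p (f - h) x = mollify φ t p f x - mollify φ t p h x := by
  have key : ∀ {k : E → V}, LocallyIntegrable k →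
      ConvolutionExists (φ.normed volume) k (lsmul ℝ ℝ) volume := fun hk =>
    φ.hasCompactSupport_normed.convolutionExists_left _ φ.continuous_normed hk
  simp only [mollify, convolution_lsmul, Pi.sub_apply, smul_sub]
  exact integral_sub (key hf _) (key hh _)

theorem integral_norm_convolution_normed_le (φ : ContDiffBump (0 : E)) {f : E → V}
    (hf : Integrable f) :
    ∫ x, ‖(φ.normed volume ⋆[lsmul ℝ ℝ, volume] f) x‖ ≤ ∫ x, ‖f x‖ := by
  have h1 : ∫ x, (φ.normed volume ⋆[lsmul ℝ ℝ, volume] fun y => ‖f y‖) x = ∫ x, ‖f x‖ := by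
    rw [integral_convolution (lsmul ℝ ℝ) φ.integrable_normed hf.norm, φ.integral_normed]
    simp
  rw [← h1]
  refine integral_mono (φ.integrable_normed.integrable_convolution (lsmul ℝ ℝ) hf).norm
    (φ.integrable_normed.integrable_convolution (lsmul ℝ ℝ) hf.norm) fun x => ?_
  simp only [convolution_lsmul]
  refine (norm_integral_le_integral_norm _).trans_eq (integral_congr_ae ?_)
  refine Eventually.of_forall fun y => ?_
  simp [norm_smul, abs_of_nonneg (φ.nonneg_normed y)]

theorem integral_norm_mollify_le (φ : ContDiffBump (0 : E)) {t : ℝ} (ht : t ≤ 1 / 2) (p : E)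
    {f : E → V} (hf : Integrable f) :
    ∫ x, ‖mollify φ t p f x‖ ≤ 2 ^ Module.finrank ℝ E * ∫ x, ‖f x‖ :=
  (integral_norm_comp_affine_le (φ.normed volume ⋆[lsmul ℝ ℝ, volume] f) (by linarith) _).trans
    (mul_le_mul_of_nonneg_left (integral_norm_convolution_normed_le φ hf) (by positivity))

variable [CompleteSpace V] {φ : ℕ → ContDiffBump (0 : E)} {t : ℕ → ℝ}

theorem tendsto_mollify_of_hasCompactSupport
    (hφ : Tendsto (fun n => (φ n).rOut) atTop (𝓝 0)) (hφ1 : ∀ n, (φ n).rOut ≤ 1)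
    (ht : Tendsto t atTop (𝓝 0)) (ht0 : ∀ n, 0 ≤ t n) (ht1 : ∀ n, t n ≤ 1 / 2) (p : E) {h : E → V}
    (hc : Continuous h) (hs : HasCompactSupport h) :
    Tendsto (fun n => ∫ x, ‖mollify (φ n) (t n) p h x - h x‖) atTop (𝓝 0) := by
  have hi : Integrable h := hc.integrable_of_hasCompactSupport hs
  obtain ⟨C, hC⟩ := hc.bounded_above_of_compact_support hs
  obtain ⟨R, hR⟩ : ∃ R, ∀ x, R ≤ ‖x‖ → h x = 0 := by
    obtain ⟨R, hR⟩ := hs.isBounded.subset_ball (0 : E)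
    refine ⟨R, fun x hx => ?_⟩
    by_contra h0
    have := hR (subset_tsupport _ h0)
    rw [mem_ball_zero_iff] at this
    linarith
  have hC0 : 0 ≤ C := (norm_nonneg _).trans (hC 0)
  set R' := max R (2 * (R + 1 + ‖p‖)) with hR'
  have key : Tendsto (fun n => ∫ x, ‖mollify (φ n) (t n) p h x - h x‖) atTop
      (𝓝 (∫ _ : E, (0 : ℝ))) := by
    refine tendsto_integral_of_dominated_convergence
      (bound := (closedBall (0 : E) R').indicator fun _ => 4 * C) ?_ ?_ ?_ ?_
    · exact fun n => ((integrable_mollify (φ n) (ht1 n) p hi).sub hi).norm.aestronglyMeasurable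
    · rw [integrable_indicator_iff measurableSet_closedBall]
      exact integrableOn_const (isCompact_closedBall _ _).measure_lt_top.ne
    · refine fun n => Eventually.of_forall fun x => ?_
      rw [norm_norm]
      by_cases hx : x ∈ closedBall (0 : E) R'
      · rw [indicator_of_mem hx]
        have h2 : ‖mollify (φ n) (t n) p h x - h ((1 - t n) • x + t n • p)‖ ≤ 2 * C := by
          rw [← dist_eq_norm]
          refine (φ n).dist_normed_convolution_le hc.aestronglyMeasurable fun y _ => ?_
          rw [dist_eq_norm]
          refine (norm_sub_le _ _).trans ?_
          linarith [hC y, hC ((1 - t n) • x + t n • p)]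
        have e : mollify (φ n) (t n) p h x - h x
            = (mollify (φ n) (t n) p h x - h ((1 - t n) • x + t n • p))
              + (h ((1 - t n) • x + t n • p) - h x) := by abel
        rw [e]
        have h3 := norm_sub_le (h ((1 - t n) • x + t n • p)) (h x)
        refine (norm_add_le _ _).trans ?_
        linarith [hC x, hC ((1 - t n) • x + t n • p)]
      · rw [indicator_of_notMem hx]
        rw [mem_closedBall_zero_iff, not_le, hR', max_lt_iff] at hx
        have hz : R + 1 ≤ ‖(1 - t n) • x + t n • p‖ := by
          have h1 := norm_sub_le ((1 - t n) • x + t n • p) (t n • p)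
          rw [add_sub_cancel_right, norm_smul, norm_smul, Real.norm_of_nonneg (ht0 n),
            Real.norm_of_nonneg (by linarith [ht1 n])] at h1
          nlinarith [ht0 n, ht1 n, norm_nonneg p, norm_nonneg x]
        have hz0 : mollify (φ n) (t n) p h x = 0 := by
          rw [mollify, (φ n).normed_convolution_eq_right]
          · exact hR _ (by linarith)
          · intro y hy
            rw [hR _ (by linarith : R ≤ ‖(1 - t n) • x + t n • p‖)]
            refine hR _ ?_
            rw [mem_ball, dist_comm, dist_eq_norm] at hy
            have := norm_sub_norm_le ((1 - t n) • x + t n • p) y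
            linarith [hφ1 n]
        rw [hz0, hR x hx.1.le]
        simp
    · refine Eventually.of_forall fun x => ?_
      have hk : Tendsto (fun n => (1 - t n) • x + t n • p) atTop (𝓝 x) := by
        have := ((tendsto_const_nhds (x := (1 : ℝ))).sub ht).smul_const x |>.add (ht.smul_const p)
        simpa using this
      have := ContDiffBump.convolution_tendsto_right (μ := volume) (g := fun _ => h) hφ
        (Eventually.of_forall fun _ => hc.aestronglyMeasurable)
        ((hc.tendsto x).comp tendsto_snd) hk
      exact tendsto_iff_norm_sub_tendsto_zero.1 this
  simpa using key

/-- Contracted mollifications converge in `L¹`. -/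
theorem tendsto_mollify
    (hφ : Tendsto (fun n => (φ n).rOut) atTop (𝓝 0)) (hφ1 : ∀ n, (φ n).rOut ≤ 1)
    (ht : Tendsto t atTop (𝓝 0)) (ht0 : ∀ n, 0 ≤ t n) (ht1 : ∀ n, t n ≤ 1 / 2) (p : E) {f : E → V}
    (hf : Integrable f) :
    Tendsto (fun n => ∫ x, ‖mollify (φ n) (t n) p f x - f x‖) atTop (𝓝 0) := by
  rw [Metric.tendsto_atTop]
  intro ε hε
  set M : ℝ := 2 ^ Module.finrank ℝ E + 1 with hM
  have hM0 : 0 < M := by positivity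
  obtain ⟨h, hs, hfh, hc, hi⟩ :=
    hf.exists_hasCompactSupport_integral_sub_le (ε := ε / (2 * M)) (by positivity)
  obtain ⟨n₀, hn₀⟩ := Metric.tendsto_atTop.1
    (tendsto_mollify_of_hasCompactSupport hφ hφ1 ht ht0 ht1 p hc hs) (ε / 2) (half_pos hε)
  refine ⟨n₀, fun n hn => ?_⟩
  have h1 := hn₀ n hn
  rw [Real.dist_eq, sub_zero, abs_of_nonneg (integral_nonneg fun _ => norm_nonneg _)] at h1 ⊢
  have hmf := integrable_mollify (φ n) (ht1 n) p hf
  have hmh := integrable_mollify (φ n) (ht1 n) p hi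
  have hmd := integrable_mollify (φ n) (ht1 n) p (hf.sub hi)
  have h2 := integral_norm_mollify_le (φ n) (ht1 n) p (hf.sub hi)
  have h3 : ∫ x, ‖mollify (φ n) (t n) p f x - f x‖ ≤
      ∫ x, ((‖mollify (φ n) (t n) p (f - h) x‖ + ‖mollify (φ n) (t n) p h x - h x‖)
        + ‖f x - h x‖) := by
    refine integral_mono (hmf.sub hf).norm
      ((hmd.norm.add (hmh.sub hi).norm).add (hf.sub hi).norm) fun x => ?_
    have e : mollify (φ n) (t n) p f x - f x = mollify (φ n) (t n) p (f - h) x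
        + (mollify (φ n) (t n) p h x - h x) - (f x - h x) := by
      rw [mollify_sub _ _ _ hf.locallyIntegrable hi.locallyIntegrable]; abel
    simp only
    rw [e]
    exact (norm_sub_le _ _).trans (add_le_add (norm_add_le _ _) le_rfl)
  have h7 : Integrable fun x => ‖mollify (φ n) (t n) p h x - h x‖ := (hmh.sub hi).norm
  have h8 : Integrable fun x => ‖f x - h x‖ := (hf.sub hi).norm
  have h9 : Integrable fun x =>
      ‖mollify (φ n) (t n) p (f - h) x‖ + ‖mollify (φ n) (t n) p h x - h x‖ := hmd.norm.add h7
  rw [integral_add h9 h8, integral_add hmd.norm h7] at h3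
  have h4 : 2 ^ Module.finrank ℝ E * ∫ x, ‖(f - h) x‖
      ≤ 2 ^ Module.finrank ℝ E * (ε / (2 * M)) :=
    mul_le_mul_of_nonneg_left hfh (by positivity)
  have h5 : 2 ^ Module.finrank ℝ E * (ε / (2 * M)) + ε / (2 * M) = ε / 2 := by
    rw [hM]; field_simp
  have h6 : ∫ x, ‖(f - h) x‖ = ∫ x, ‖f x - h x‖ := rfl
  linarith

end Mollify

/-! ### Approximation of Sobolev functions on bounded convex open sets -/

section Approximation

variable {N : ℕ} {S : Set (EuclideanSpace ℝ (Fin N))} {u : EuclideanSpace ℝ (Fin N) → ℝ}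
  {g : EuclideanSpace ℝ (Fin N) → EuclideanSpace ℝ (Fin N)}

theorem HasWeakGradient.mono {T : Set (EuclideanSpace ℝ (Fin N))} (h : HasWeakGradient T u g)
    (hST : S ⊆ T) : HasWeakGradient S u g where
  locallyIntegrableOn := h.locallyIntegrableOn.mono_set hST
  locallyIntegrableOn_grad := h.locallyIntegrableOn_grad.mono_set hST
  integral_eq φ hφ hc hs v := by
    have hz : ∀ x, x ∉ S → φ x = 0 := fun x hx => by
      by_contra h0; exact hx (hs (subset_tsupport _ h0))
    have hz' : ∀ x, x ∉ S → fderiv ℝ φ x v = 0 := fun x hx => by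
      have : fderiv ℝ φ x = 0 := by
        by_contra h0
        exact hx (hs (support_fderiv_subset ℝ h0))
      simp [this]
    have key := h.integral_eq φ hφ hc (hs.trans hST) v
    rw [setIntegral_eq_integral_of_forall_compl_eq_zero fun x hx => by
        rw [hz' x fun h => hx (hST h), mul_zero],
      setIntegral_eq_integral_of_forall_compl_eq_zero fun x hx => by
        rw [hz x fun h => hx (hST h), zero_mul]] at key
    rw [setIntegral_eq_integral_of_forall_compl_eq_zero fun x hx => by rw [hz' x hx, mul_zero],
      setIntegral_eq_integral_of_forall_compl_eq_zero fun x hx => by rw [hz x hx, zero_mul], key]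

/-- Mollification commutes with weak derivatives where the support of the mollifier stays
in `S`. -/
theorem HasWeakGradient.fderiv_convolution_apply (h : HasWeakGradient S u g) (hS : IsOpen S)
    (hu : IntegrableOn u S) (hg : IntegrableOn g S)
    (φ : ContDiffBump (0 : EuclideanSpace ℝ (Fin N))) {z : EuclideanSpace ℝ (Fin N)}
    (hz : closedBall z φ.rOut ⊆ S) (v : EuclideanSpace ℝ (Fin N)) :
    fderiv ℝ (φ.normed volume ⋆[lsmul ℝ ℝ, volume] S.indicator u) z v
      = ⟪(φ.normed volume ⋆[lsmul ℝ ℝ, volume] S.indicator g) z, v⟫ := by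
  have hu' : Integrable (S.indicator u) := (integrable_indicator_iff hS.measurableSet).2 hu
  have hg' : Integrable (S.indicator g) := (integrable_indicator_iff hS.measurableSet).2 hg
  have hφc : ContDiff ℝ 1 (φ.normed volume) := φ.contDiff_normed
  have hφs := φ.hasCompactSupport_normed (μ := volume)
  set ψ : EuclideanSpace ℝ (Fin N) → ℝ := fun w => φ.normed volume (z - w) with hψ
  have hψd : ∀ w, fderiv ℝ ψ w v = -fderiv ℝ (φ.normed volume) (z - w) v := by
    intro w
    have := ((hφc.differentiable one_ne_zero (z - w)).hasFDerivAt.comp w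
      ((hasFDerivAt_id w).const_sub z)).fderiv
    have e : ψ = φ.normed volume ∘ HSub.hSub z := rfl
    rw [e, this]
    simp
  have hψts : tsupport ψ ⊆ closedBall z φ.rOut := by
    refine closure_minimal (fun w hw => ?_) isClosed_closedBall
    have : z - w ∈ Function.support (φ.normed volume) := hw
    rw [φ.support_normed_eq, mem_ball_zero_iff] at this
    rw [mem_closedBall, dist_comm, dist_eq_norm]
    exact this.le
  have hψcs : HasCompactSupport ψ :=
    (isCompact_closedBall z φ.rOut).of_isClosed_subset (isClosed_tsupport _) hψts
  have key := h.integral_eq ψ (φ.contDiff_normed.comp (contDiff_const.sub contDiff_id)) hψcs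
    (hψts.trans hz) v
  have e1 : fderiv ℝ (φ.normed volume ⋆[lsmul ℝ ℝ, volume] S.indicator u) z v
      = ∫ w, S.indicator u w * fderiv ℝ (φ.normed volume) (z - w) v := by
    rw [← convolution_flip, (hφs.hasFDerivAt_convolution_right _ hu'.locallyIntegrable hφc z).fderiv,
      convolution_precompR_apply _ hu'.locallyIntegrable (hφs.fderiv ℝ)
        (hφc.continuous_fderiv one_ne_zero)]
    simp [convolution, mul_comm]
  have e2 : ∫ w, S.indicator u w * fderiv ℝ (φ.normed volume) (z - w) v
      = -∫ x in S, u x * fderiv ℝ ψ x v := by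
    rw [← integral_neg, ← integral_indicator hS.measurableSet]
    refine integral_congr_ae (Eventually.of_forall fun w => ?_)
    by_cases hw : w ∈ S <;> simp [hw, hψd]
  have hint : Integrable fun w => ψ w • S.indicator g w :=
    hg'.locallyIntegrable.integrable_smul_left_of_hasCompactSupport
      (φ.continuous_normed.comp (continuous_const.sub continuous_id)) hψcs
  have e3 : ⟪(φ.normed volume ⋆[lsmul ℝ ℝ, volume] S.indicator g) z, v⟫
      = ∫ x in S, ψ x * ⟪g x, v⟫ := by
    rw [convolution_eq_swap, real_inner_comm]
    simp only [lsmul_apply]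
    rw [← integral_inner hint v, ← integral_indicator hS.measurableSet]
    refine integral_congr_ae (Eventually.of_forall fun w => ?_)
    by_cases hw : w ∈ S <;> simp [hw, real_inner_smul_right, real_inner_comm]
  rw [e1, e2, e3, key, neg_neg]

theorem eLpNorm_one_restrict_le {α V : Type*} [MeasurableSpace α] {μ : Measure α}
    [NormedAddCommGroup V] {s : Set α} (hs : MeasurableSet s) {f h : α → V} (hh : Integrable h μ)
    (hfh : ∀ x ∈ s, f x = h x) {c : ℝ} (hc : ∫ x, ‖h x‖ ∂μ ≤ c) :
    eLpNorm f 1 (μ.restrict s) ≤ ENNReal.ofReal c := by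
  calc eLpNorm f 1 (μ.restrict s) = eLpNorm h 1 (μ.restrict s) :=
        eLpNorm_congr_ae ((ae_restrict_mem hs).mono hfh)
    _ ≤ eLpNorm h 1 μ := eLpNorm_restrict_le _ _ _ s
    _ = ENNReal.ofReal (∫ x, ‖h x‖ ∂μ) := by
        rw [eLpNorm_one_eq_lintegral_enorm, ofReal_integral_norm_eq_lintegral_enorm hh]
    _ ≤ ENNReal.ofReal c := ENNReal.ofReal_le_ofReal hc

/-- On a bounded convex open set, a function with an integrable weak gradient is a limit in
`W^{1,1}` of smooth functions with compact support in the whole space. -/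
theorem HasWeakGradient.exists_tendsto (h : HasWeakGradient S u g) (hS : IsOpen S)
    (hc : Convex ℝ S) (hb : Bornology.IsBounded S)
    (hu : IntegrableOn u S) (hg : IntegrableOn g S) :
    ∃ U : ℕ → EuclideanSpace ℝ (Fin N) → ℝ,
      (∀ n, ContDiff ℝ 1 (U n)) ∧ (∀ n, HasCompactSupport (U n)) ∧
      Tendsto (fun n => eLpNorm (U n - u) 1 (volume.restrict S)) atTop (𝓝 0) ∧
      Tendsto (fun n => eLpNorm (gradient (U n) - g) 1 (volume.restrict S)) atTop (𝓝 0) := by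
  rcases S.eq_empty_or_nonempty with rfl | ⟨p, hp⟩
  · exact ⟨fun _ => 0, fun _ => contDiff_const, fun _ => HasCompactSupport.zero, by simp, by simp⟩
  obtain ⟨ρ, hρ, hball⟩ := Metric.isOpen_iff.1 hS p hp
  have hu' : Integrable (S.indicator u) := (integrable_indicator_iff hS.measurableSet).2 hu
  have hg' : Integrable (S.indicator g) := (integrable_indicator_iff hS.measurableSet).2 hg
  set ρ' := min ρ 1 with hρ'
  have hρ0 : 0 < ρ' := lt_min hρ one_pos
  set t : ℕ → ℝ := fun n => 1 / 2 * (1 / ((n : ℝ) + 1)) with ht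
  have ht0 : ∀ n, 0 < t n := fun n => by positivity
  have ht1 : ∀ n, t n ≤ 1 / 2 := fun n => by
    have : 1 / ((n : ℝ) + 1) ≤ 1 := by
      rw [div_le_one (by positivity)]
      linarith [(Nat.cast_nonneg n : (0 : ℝ) ≤ n)]
    simp only [ht]
    linarith
  have htt : Tendsto t atTop (𝓝 0) := by
    rw [← mul_zero (1 / 2 : ℝ)]
    exact tendsto_one_div_add_atTop_nhds_zero_nat.const_mul (1 / 2)
  set φ : ℕ → ContDiffBump (0 : EuclideanSpace ℝ (Fin N)) := fun n =>
    ⟨t n * ρ' / 4, t n * ρ' / 2, by have := ht0 n; positivity,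
      by have := mul_pos (ht0 n) hρ0; linarith⟩ with hφ
  have hφr : ∀ n, (φ n).rOut = t n * ρ' / 2 := fun n => rfl
  have hφt : Tendsto (fun n => (φ n).rOut) atTop (𝓝 0) := by
    simp only [hφr]
    simpa using (htt.mul_const ρ').div_const 2
  have hφ1 : ∀ n, (φ n).rOut ≤ 1 := fun n => by
    rw [hφr]
    have := min_le_right ρ 1
    nlinarith [ht0 n, ht1 n]
  have hz : ∀ n, ∀ x ∈ S, closedBall ((1 - t n) • x + t n • p) (φ n).rOut ⊆ S := by
    intro n x hx w hw
    have h0 := ht0 n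
    -- `w` lies on the segment from `x` to a point of the ball about `p`
    set y := p + (t n)⁻¹ • (w - ((1 - t n) • x + t n • p)) with hy
    have hyS : y ∈ S := by
      refine hball ?_
      rw [mem_closedBall, dist_eq_norm, hφr] at hw
      rw [mem_ball, dist_eq_norm, hy, add_sub_cancel_left, norm_smul, norm_inv,
        Real.norm_of_nonneg h0.le, inv_mul_lt_iff₀ h0]
      have := min_le_left ρ 1
      have := mul_pos h0 hρ0
      nlinarith
    have := hc hx hyS (by linarith [ht1 n] : 0 ≤ 1 - t n) h0.le (by ring)
    convert this using 1
    rw [hy, smul_add, smul_smul, mul_inv_cancel₀ h0.ne', one_smul]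
    abel
  have hlin : ∀ n, ContDiff ℝ 1
      fun x : EuclideanSpace ℝ (Fin N) => (1 - t n) • x + t n • p := fun n =>
    (contDiff_id.const_smul _).add contDiff_const
  have hconv : ∀ n, ContDiff ℝ 1 ((φ n).normed volume ⋆[lsmul ℝ ℝ, volume] S.indicator u) :=
    fun n => (φ n).hasCompactSupport_normed.contDiff_convolution_left _ (φ n).contDiff_normed
      hu'.locallyIntegrable
  have hsmooth : ∀ n, ContDiff ℝ 1 (mollify (φ n) (t n) p (S.indicator u)) := fun n =>
    (hconv n).comp (hlin n)
  have hucs : HasCompactSupport (S.indicator u) :=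
    HasCompactSupport.of_support_subset_isCompact hb.isCompact_closure
      (support_indicator_subset.trans subset_closure)
  have hcs : ∀ n, HasCompactSupport (mollify (φ n) (t n) p (S.indicator u)) := by
    intro n
    have h1 : HasCompactSupport ((φ n).normed volume ⋆[lsmul ℝ ℝ, volume] S.indicator u) :=
      HasCompactSupport.convolution _ (φ n).hasCompactSupport_normed hucs
    exact h1.comp_homeomorph ((Homeomorph.smulOfNeZero (1 - t n) (by linarith [ht1 n])).trans
      (Homeomorph.addRight (t n • p)))
  have hgrad : ∀ n, ∀ x ∈ S, gradient (mollify (φ n) (t n) p (S.indicator u)) x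
      = (1 - t n) • mollify (φ n) (t n) p (S.indicator g) x := by
    intro n x hx
    refine ext_inner_right ℝ fun v => ?_
    rw [inner_gradient_left, real_inner_smul_left]
    have h1 := (((hconv n).differentiable one_ne_zero _).hasFDerivAt.comp x
      (((hasFDerivAt_id x).const_smul (1 - t n)).add_const (t n • p))).fderiv
    have e : mollify (φ n) (t n) p (S.indicator u)
      = ((φ n).normed volume ⋆[lsmul ℝ ℝ, volume] S.indicator u) ∘
        fun x => (1 - t n) • id x + t n • p := rfl
    have h2 : (fun x => (1 - t n) • id x + t n • p)
      = fun x => ((1 - t n) • id) x + t n • p := rfl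
    rw [e, h2, h1]
    simp only [ContinuousLinearMap.comp_apply, _root_.smul_apply,
      ContinuousLinearMap.id_apply, map_smul, smul_eq_mul, Pi.smul_apply, id]
    rw [h.fderiv_convolution_apply hS hu hg (φ n) (hz n x hx)]
    rfl
  have htou := tendsto_mollify hφt hφ1 htt (fun n => (ht0 n).le) ht1 p hu'
  have htog := tendsto_mollify hφt hφ1 htt (fun n => (ht0 n).le) ht1 p hg'
  refine ⟨fun n => mollify (φ n) (t n) p (S.indicator u), hsmooth, hcs, ?_, ?_⟩
  · refine tendsto_of_tendsto_of_tendsto_of_le_of_le tendsto_const_nhds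
      (h := fun n => ENNReal.ofReal (∫ x, ‖mollify (φ n) (t n) p (S.indicator u) x
        - S.indicator u x‖)) ?_ (fun _ => bot_le) fun n => ?_
    · simpa using ENNReal.tendsto_ofReal htou
    · exact eLpNorm_one_restrict_le hS.measurableSet
        ((integrable_mollify (φ n) (ht1 n) p hu').sub hu') (fun x hx => by simp [hx]) le_rfl
  · refine tendsto_of_tendsto_of_tendsto_of_le_of_le tendsto_const_nhds
      (h := fun n => ENNReal.ofReal ((∫ x, ‖mollify (φ n) (t n) p (S.indicator g) x
        - S.indicator g x‖) + t n * ∫ x, ‖S.indicator g x‖)) ?_ (fun _ => bot_le) fun n => ?_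
    · simpa using ENNReal.tendsto_ofReal (htog.add (htt.mul_const _))
    · have hi1 : Integrable fun x => mollify (φ n) (t n) p (S.indicator g) x - S.indicator g x :=
        (integrable_mollify (φ n) (ht1 n) p hg').sub hg'
      have hi2 : Integrable fun x => (1 - t n) •
          (mollify (φ n) (t n) p (S.indicator g) x - S.indicator g x) - t n • S.indicator g x :=
        (hi1.smul (1 - t n)).sub (hg'.smul (t n))
      refine eLpNorm_one_restrict_le hS.measurableSet hi2 (fun x hx => ?_) ?_
      · simp only [Pi.sub_apply, hgrad n x hx, indicator_of_mem hx]
        rw [smul_sub, sub_smul 1 (t n) (g x), one_smul]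
        abel
      · rw [← integral_const_mul, ← integral_add hi1.norm (hg'.norm.const_mul _)]
        refine integral_mono hi2.norm (hi1.norm.add (hg'.norm.const_mul _)) fun x => ?_
        refine (norm_sub_le _ _).trans (add_le_add ?_ ?_)
        · rw [norm_smul, Real.norm_of_nonneg (by linarith [ht1 n])]
          exact mul_le_of_le_one_left (norm_nonneg _) (by linarith [ht0 n])
        · rw [norm_smul, Real.norm_of_nonneg (ht0 n).le]

end Approximation

/-! ### Composition with a map that does not concentrate measure -/

section Comp

variable {α β V : Type*} [MeasurableSpace α] [MeasurableSpace β] [NormedAddCommGroup V]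
  {μ : Measure α} {ν : Measure β} {F : α → β} {f : β → V} {M : ℝ≥0∞}

theorem aestronglyMeasurable_comp_of_map_le (hF : Measurable F) (h : μ.map F ≤ M • ν)
    (hf : AEStronglyMeasurable f ν) : AEStronglyMeasurable (f ∘ F) μ :=
  (hf.mono_ac ((Measure.absolutelyContinuous_of_le h).trans
    Measure.smul_absolutelyContinuous)).comp_measurable hF

theorem eLpNorm_comp_le_of_map_le (hF : Measurable F) (h : μ.map F ≤ M • ν)
    (hf : AEStronglyMeasurable f ν) {p : ℝ≥0∞} (hp : p ≠ ⊤) :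
    eLpNorm (f ∘ F) p μ ≤ M ^ (1 / p).toReal * eLpNorm f p ν := by
  have hf' : AEStronglyMeasurable f (μ.map F) := hf.mono_ac
    ((Measure.absolutelyContinuous_of_le h).trans Measure.smul_absolutelyContinuous)
  rw [← eLpNorm_map_measure hf' hF.aemeasurable]
  refine (eLpNorm_mono_measure f h).trans_eq ?_
  rw [eLpNorm_smul_measure_of_ne_top hp, smul_eq_mul]

end Comp

/-! ### Extension operators of the form `u ↦ η * (u ∘ F)` -/

section Extension

variable {N : ℕ} {Ω W : Set (EuclideanSpace ℝ (Fin N))}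
  {F : EuclideanSpace ℝ (Fin N) → EuclideanSpace ℝ (Fin N)} {η : EuclideanSpace ℝ (Fin N) → ℝ}
  {L L' : ℝ≥0} {M : ℝ≥0∞} {u : EuclideanSpace ℝ (Fin N) → ℝ}
  {g : EuclideanSpace ℝ (Fin N) → EuclideanSpace ℝ (Fin N)}

/-- The function `η * (u ∘ F)`. -/
def extFun (F : EuclideanSpace ℝ (Fin N) → EuclideanSpace ℝ (Fin N))
    (η : EuclideanSpace ℝ (Fin N) → ℝ) (u : EuclideanSpace ℝ (Fin N) → ℝ)
    (x : EuclideanSpace ℝ (Fin N)) : ℝ := η x * u (F x)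

/-- The gradient of `η * (u ∘ F)` as given by the product and chain rules, when `g` is the gradient
of `u`. At the points where `F` or `η` is not differentiable, a null set, it is a junk value. -/
def extGrad (F : EuclideanSpace ℝ (Fin N) → EuclideanSpace ℝ (Fin N))
    (η : EuclideanSpace ℝ (Fin N) → ℝ) (u : EuclideanSpace ℝ (Fin N) → ℝ)
    (g : EuclideanSpace ℝ (Fin N) → EuclideanSpace ℝ (Fin N))
    (x : EuclideanSpace ℝ (Fin N)) : EuclideanSpace ℝ (Fin N) :=
  η x • ContinuousLinearMap.adjoint (fderiv ℝ F x) (g (F x)) + u (F x) • gradient η x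

/-- A Lipschitz map `F` and a Lipschitz cutoff `η` which extend functions from `Ω` to the whole
space by `η * (u ∘ F)`: up to a null set `η` vanishes off `W`, and `F` maps `W` into `Ω` without
concentrating Lebesgue measure by more than a factor `M`. -/
structure ExtensionData (Ω W : Set (EuclideanSpace ℝ (Fin N)))
    (F : EuclideanSpace ℝ (Fin N) → EuclideanSpace ℝ (Fin N)) (η : EuclideanSpace ℝ (Fin N) → ℝ)
    (L L' : ℝ≥0) (M : ℝ≥0∞) : Prop where
  lipschitz_map : LipschitzWith L F
  lipschitz_cutoff : LipschitzWith L' η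
  cutoff_nonneg : ∀ x, 0 ≤ η x
  cutoff_le_one : ∀ x, η x ≤ 1
  measurableSet : MeasurableSet W
  map_le : (volume.restrict W).map F ≤ M • volume.restrict Ω
  ne_top : M ≠ ⊤
  ae_eq_zero : ∀ᵐ x, x ∉ W → η x = 0

theorem extFun_sub (u₁ u₂ : EuclideanSpace ℝ (Fin N) → ℝ) :
    extFun F η u₁ - extFun F η u₂ = extFun F η (u₁ - u₂) := by
  ext x
  simp [extFun, mul_sub]

theorem extGrad_sub (u₁ u₂ : EuclideanSpace ℝ (Fin N) → ℝ)
    (g₁ g₂ : EuclideanSpace ℝ (Fin N) → EuclideanSpace ℝ (Fin N)) :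
    extGrad F η u₁ g₁ - extGrad F η u₂ g₂ = extGrad F η (u₁ - u₂) (g₁ - g₂) := by
  ext1 x
  simp only [extGrad, Pi.sub_apply, map_sub, smul_sub, sub_smul]
  abel

theorem norm_gradient (f : EuclideanSpace ℝ (Fin N) → ℝ) (x : EuclideanSpace ℝ (Fin N)) :
    ‖gradient f x‖ = ‖fderiv ℝ f x‖ := by
  rw [gradient, LinearIsometryEquiv.norm_map]

theorem lipschitzWith_mul_of_bounded {X : Type*} [PseudoMetricSpace X] {f h : X → ℝ} {A B C D : ℝ≥0}
    (hf : LipschitzWith A f) (hh : LipschitzWith B h) (hfb : ∀ x, |f x| ≤ C)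
    (hhb : ∀ x, |h x| ≤ D) : LipschitzWith (C * B + D * A) fun x => f x * h x := by
  refine LipschitzWith.of_dist_le_mul fun x y => ?_
  have e : f x * h x - f y * h y = f x * (h x - h y) + h y * (f x - f y) := by ring
  have h1 := hf.dist_le_mul x y
  have h2 := hh.dist_le_mul x y
  rw [Real.dist_eq] at h1 h2 ⊢
  rw [e]
  refine (abs_add_le _ _).trans ?_
  rw [abs_mul, abs_mul]
  have h3 := mul_le_mul (hfb x) h2 (abs_nonneg _) C.2
  have h4 := mul_le_mul (hhb y) h1 (abs_nonneg _) D.2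
  push_cast
  linarith

namespace ExtensionData

variable (h : ExtensionData Ω W F η L L' M)
include h

theorem norm_extFun_le (u : EuclideanSpace ℝ (Fin N) → ℝ) :
    ∀ᵐ x, ‖extFun F η u x‖ ≤ ‖W.indicator (u ∘ F) x‖ := by
  filter_upwards [h.ae_eq_zero] with x hx
  by_cases hxW : x ∈ W
  · rw [indicator_of_mem hxW, extFun, norm_mul, Real.norm_of_nonneg (h.cutoff_nonneg x)]
    exact mul_le_of_le_one_left (norm_nonneg _) (h.cutoff_le_one x)
  · simp [extFun, hx hxW]

theorem extGrad_eq_zero (u : EuclideanSpace ℝ (Fin N) → ℝ)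
    (g : EuclideanSpace ℝ (Fin N) → EuclideanSpace ℝ (Fin N)) {x : EuclideanSpace ℝ (Fin N)}
    (hx : η x = 0) : extGrad F η u g x = 0 := by
  -- the nonnegative function `η` has a minimum at `x`
  have hmin : IsLocalMin η x := Eventually.of_forall fun y => hx ▸ h.cutoff_nonneg y
  have : gradient η x = 0 := by rw [gradient, hmin.fderiv_eq_zero, map_zero]
  simp [extGrad, hx, this]

theorem norm_extGrad_le (u : EuclideanSpace ℝ (Fin N) → ℝ)
    (g : EuclideanSpace ℝ (Fin N) → EuclideanSpace ℝ (Fin N)) :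
    ∀ᵐ x, ‖extGrad F η u g x‖
      ≤ ‖W.indicator (fun x => (L : ℝ) * ‖g (F x)‖ + (L' : ℝ) * ‖u (F x)‖) x‖ := by
  filter_upwards [h.ae_eq_zero] with x hx
  by_cases hxW : x ∈ W
  · rw [indicator_of_mem hxW, Real.norm_of_nonneg (by positivity)]
    refine (norm_add_le _ _).trans (add_le_add ?_ ?_)
    · rw [norm_smul, Real.norm_of_nonneg (h.cutoff_nonneg x)]
      refine (mul_le_of_le_one_left (norm_nonneg _) (h.cutoff_le_one x)).trans ?_
      refine (ContinuousLinearMap.le_opNorm _ _).trans ?_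
      rw [LinearIsometryEquiv.norm_map]
      exact mul_le_mul_of_nonneg_right (norm_fderiv_le_of_lipschitz ℝ h.lipschitz_map)
        (norm_nonneg _)
    · rw [norm_smul, norm_gradient, mul_comm]
      exact mul_le_mul_of_nonneg_right (norm_fderiv_le_of_lipschitz ℝ h.lipschitz_cutoff)
        (norm_nonneg _)
  · rw [h.extGrad_eq_zero u g (hx hxW), norm_zero]
    exact norm_nonneg _

theorem eLpNorm_extFun_le {μ : Measure (EuclideanSpace ℝ (Fin N))} (hμ : μ ≪ volume)
    (p : ℝ≥0∞) (u : EuclideanSpace ℝ (Fin N) → ℝ) :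
    eLpNorm (extFun F η u) p μ ≤ eLpNorm (u ∘ F) p (μ.restrict W) := by
  rw [← eLpNorm_indicator_eq_eLpNorm_restrict h.measurableSet]
  exact eLpNorm_mono_ae (hμ.ae_le (h.norm_extFun_le u))

theorem eLpNorm_extGrad_le {μ : Measure (EuclideanSpace ℝ (Fin N))} (hμ : μ ≪ volume)
    {p : ℝ≥0∞} (hp : 1 ≤ p) (hu : AEStronglyMeasurable (u ∘ F) (μ.restrict W))
    (hg : AEStronglyMeasurable (g ∘ F) (μ.restrict W)) :
    eLpNorm (extGrad F η u g) p μ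
      ≤ L * eLpNorm (g ∘ F) p (μ.restrict W) + L' * eLpNorm (u ∘ F) p (μ.restrict W) := by
  refine (eLpNorm_mono_ae (hμ.ae_le (h.norm_extGrad_le u g))).trans ?_
  rw [eLpNorm_indicator_eq_eLpNorm_restrict h.measurableSet]
  have e : (fun x => (L : ℝ) * ‖g (F x)‖ + (L' : ℝ) * ‖u (F x)‖)
      = (L : ℝ) • (fun x => ‖(g ∘ F) x‖) + (L' : ℝ) • fun x => ‖(u ∘ F) x‖ := rfl
  rw [e]
  refine (eLpNorm_add_le (hg.norm.const_smul _) (hu.norm.const_smul _) hp).trans_eq ?_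
  rw [eLpNorm_const_smul, eLpNorm_const_smul, eLpNorm_norm, eLpNorm_norm]
  simp

theorem map_restrict_ball_le (R : ℝ) :
    ((volume.restrict (ball 0 R)).restrict W).map F
      ≤ M • volume.restrict (Ω ∩ ball 0 (‖F 0‖ + L * R + 1)) := by
  have hF := h.lipschitz_map.continuous.measurable
  set R' := ‖F 0‖ + L * R + 1
  have hsub : ball 0 R ⊆ F ⁻¹' ball 0 R' := by
    intro x hx
    rw [mem_ball_zero_iff] at hx
    have h1 := h.lipschitz_map.dist_le_mul x 0
    rw [dist_eq_norm, dist_zero_right] at h1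
    have h2 := norm_sub_norm_le (F x) (F 0)
    have h3 : (L : ℝ) * ‖x‖ ≤ L * R := mul_le_mul_of_nonneg_left hx.le L.2
    rw [mem_preimage, mem_ball_zero_iff]
    linarith
  have h1 : (volume.restrict (ball 0 R)).restrict W
      ≤ (volume.restrict W).restrict (F ⁻¹' ball 0 R') := by
    rw [Measure.restrict_restrict h.measurableSet, inter_comm,
      ← Measure.restrict_restrict measurableSet_ball]
    exact Measure.restrict_mono hsub le_rfl
  refine (Measure.map_mono h1 hF).trans ?_
  rw [← Measure.restrict_map hF measurableSet_ball]
  refine (Measure.restrict_mono le_rfl h.map_le).trans_eq ?_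
  rw [Measure.restrict_smul, Measure.restrict_restrict measurableSet_ball, inter_comm]


theorem eLpNorm_extFun_restrict_ball_le (R : ℝ)
    (hu : AEStronglyMeasurable u (volume.restrict (Ω ∩ ball 0 (‖F 0‖ + L * R + 1)))) :
    eLpNorm (extFun F η u) 1 (volume.restrict (ball 0 R))
      ≤ M * eLpNorm u 1 (volume.restrict (Ω ∩ ball 0 (‖F 0‖ + L * R + 1))) := by
  refine (h.eLpNorm_extFun_le Measure.absolutelyContinuous_restrict 1 u).trans ?_
  refine (eLpNorm_comp_le_of_map_le h.lipschitz_map.continuous.measurable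
    (h.map_restrict_ball_le R) hu ENNReal.one_ne_top).trans_eq ?_
  simp

theorem eLpNorm_extGrad_restrict_ball_le (R : ℝ)
    (hu : AEStronglyMeasurable u (volume.restrict (Ω ∩ ball 0 (‖F 0‖ + L * R + 1))))
    (hg : AEStronglyMeasurable g (volume.restrict (Ω ∩ ball 0 (‖F 0‖ + L * R + 1)))) :
    eLpNorm (extGrad F η u g) 1 (volume.restrict (ball 0 R))
      ≤ L * (M * eLpNorm g 1 (volume.restrict (Ω ∩ ball 0 (‖F 0‖ + L * R + 1))))
        + L' * (M * eLpNorm u 1 (volume.restrict (Ω ∩ ball 0 (‖F 0‖ + L * R + 1)))) := by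
  have hF := h.lipschitz_map.continuous.measurable
  have hm := h.map_restrict_ball_le R
  refine (h.eLpNorm_extGrad_le Measure.absolutelyContinuous_restrict le_rfl
    (aestronglyMeasurable_comp_of_map_le hF hm hu)
    (aestronglyMeasurable_comp_of_map_le hF hm hg)).trans ?_
  have h1 := eLpNorm_comp_le_of_map_le hF hm hu ENNReal.one_ne_top
  have h2 := eLpNorm_comp_le_of_map_le hF hm hg ENNReal.one_ne_top
  simp only [div_one, ENNReal.toReal_one, ENNReal.rpow_one] at h1 h2
  gcongr

theorem aestronglyMeasurable_extFun (hu : AEStronglyMeasurable u (volume.restrict Ω)) :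
    AEStronglyMeasurable (extFun F η u) volume := by
  have h1 : AEStronglyMeasurable (extFun F η u) (volume.restrict W) :=
    h.lipschitz_cutoff.continuous.aestronglyMeasurable.mul
      (aestronglyMeasurable_comp_of_map_le h.lipschitz_map.continuous.measurable h.map_le hu)
  refine ((aestronglyMeasurable_indicator_iff h.measurableSet).2 h1).congr ?_
  filter_upwards [h.ae_eq_zero] with x hx
  by_cases hxW : x ∈ W
  · rw [indicator_of_mem hxW]
  · rw [indicator_of_notMem hxW, extFun, hx hxW, zero_mul]

theorem aestronglyMeasurable_extGrad (hu : AEStronglyMeasurable u (volume.restrict Ω))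
    (hg : AEStronglyMeasurable g (volume.restrict Ω)) :
    AEStronglyMeasurable (extGrad F η u g) volume := by
  have hF := h.lipschitz_map.continuous.measurable
  have hu' := aestronglyMeasurable_comp_of_map_le hF h.map_le hu
  have hg' := aestronglyMeasurable_comp_of_map_le hF h.map_le hg
  have hadj : AEStronglyMeasurable (fun x => ContinuousLinearMap.adjoint (fderiv ℝ F x))
      (volume.restrict W) :=
    (LinearIsometryEquiv.continuous _).comp_aestronglyMeasurable
      (measurable_fderiv ℝ F).aestronglyMeasurable
  have happ : AEStronglyMeasurable
      (fun x => ContinuousLinearMap.adjoint (fderiv ℝ F x) (g (F x))) (volume.restrict W) :=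
    (isBoundedBilinearMap_apply.continuous).comp_aestronglyMeasurable (hadj.prodMk hg')
  have hgr : AEStronglyMeasurable (gradient η) (volume.restrict W) :=
    (LinearIsometryEquiv.continuous _).comp_aestronglyMeasurable
      (measurable_fderiv ℝ η).aestronglyMeasurable
  have h1 : AEStronglyMeasurable (extGrad F η u g) (volume.restrict W) :=
    (h.lipschitz_cutoff.continuous.aestronglyMeasurable.smul happ).add (hu'.smul hgr)
  refine ((aestronglyMeasurable_indicator_iff h.measurableSet).2 h1).congr ?_
  filter_upwards [h.ae_eq_zero] with x hx
  by_cases hxW : x ∈ W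
  · rw [indicator_of_mem hxW]
  · rw [indicator_of_notMem hxW, h.extGrad_eq_zero u g (hx hxW)]

omit h in
theorem locallyIntegrable_of_forall_ball {V : Type*} [NormedAddCommGroup V]
    {f : EuclideanSpace ℝ (Fin N) → V} (hf : ∀ R, IntegrableOn f (ball 0 R)) :
    LocallyIntegrable f := fun x =>
  ⟨ball 0 (‖x‖ + 1), isOpen_ball.mem_nhds (by simp), hf _⟩

theorem locallyIntegrable_extFun
    (hum : AEStronglyMeasurable u (volume.restrict Ω))
    (hu : ∀ R, IntegrableOn u (Ω ∩ ball 0 R)) : LocallyIntegrable (extFun F η u) := by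
  refine locallyIntegrable_of_forall_ball fun R => ?_
  rw [IntegrableOn, ← memLp_one_iff_integrable]
  refine ⟨(h.aestronglyMeasurable_extFun hum).restrict, ?_⟩
  have h1 := memLp_one_iff_integrable.2 (hu (‖F 0‖ + L * R + 1))
  exact (h.eLpNorm_extFun_restrict_ball_le R h1.1).trans_lt
    (ENNReal.mul_lt_top h.ne_top.lt_top h1.2)

theorem locallyIntegrable_extGrad
    (hum : AEStronglyMeasurable u (volume.restrict Ω))
    (hgm : AEStronglyMeasurable g (volume.restrict Ω))
    (hu : ∀ R, IntegrableOn u (Ω ∩ ball 0 R)) (hg : ∀ R, IntegrableOn g (Ω ∩ ball 0 R)) :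
    LocallyIntegrable (extGrad F η u g) := by
  refine locallyIntegrable_of_forall_ball fun R => ?_
  rw [IntegrableOn, ← memLp_one_iff_integrable]
  refine ⟨(h.aestronglyMeasurable_extGrad hum hgm).restrict, ?_⟩
  have h1 := memLp_one_iff_integrable.2 (hu (‖F 0‖ + L * R + 1))
  have h2 := memLp_one_iff_integrable.2 (hg (‖F 0‖ + L * R + 1))
  exact (h.eLpNorm_extGrad_restrict_ball_le R h1.1 h2.1).trans_lt (ENNReal.add_lt_top.2
    ⟨ENNReal.mul_lt_top ENNReal.coe_lt_top (ENNReal.mul_lt_top h.ne_top.lt_top h2.2),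
      ENNReal.mul_lt_top ENNReal.coe_lt_top (ENNReal.mul_lt_top h.ne_top.lt_top h1.2)⟩)

/-- Integration by parts for the extension of a smooth function; `η * (U ∘ F)` is then Lipschitz, and
Rademacher's theorem gives its derivative almost everywhere. -/
theorem integral_extFun_of_contDiff {U φ : EuclideanSpace ℝ (Fin N) → ℝ} (hU : ContDiff ℝ 1 U)
    (hUc : HasCompactSupport U) (hφ : ContDiff ℝ 1 φ) (hφc : HasCompactSupport φ)
    (v : EuclideanSpace ℝ (Fin N)) :
    ∫ x, extFun F η U x * fderiv ℝ φ x v = -∫ x, φ x * ⟪extGrad F η U (gradient U) x, v⟫ := by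
  obtain ⟨A, hA⟩ := hU.lipschitzWith_of_hasCompactSupport hUc one_ne_zero
  obtain ⟨B, hB⟩ := hφ.lipschitzWith_of_hasCompactSupport hφc one_ne_zero
  obtain ⟨C, hC⟩ := hU.continuous.bounded_above_of_compact_support hUc
  have hC' : ∀ x, |(U ∘ F) x| ≤ C.toNNReal := fun x => (hC (F x)).trans (Real.le_coe_toNNReal C)
  have hη : ∀ x, |η x| ≤ (1 : ℝ≥0) := fun x => by
    rw [abs_of_nonneg (h.cutoff_nonneg x)]; exact h.cutoff_le_one x
  have hlip := lipschitzWith_mul_of_bounded h.lipschitz_cutoff (hA.comp h.lipschitz_map) hη hC'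
  have key := hlip.integral_lineDeriv_mul_eq (μ := volume) hB hφc v
  have e1 : ∫ x, lineDeriv ℝ (fun x => η x * (U ∘ F) x) x v * φ x
      = ∫ x, φ x * ⟪extGrad F η U (gradient U) x, v⟫ := by
    refine integral_congr_ae ?_
    filter_upwards [h.lipschitz_map.ae_differentiableAt,
      h.lipschitz_cutoff.ae_differentiableAt] with x hFx hηx
    have hUF := (hU.differentiable one_ne_zero (F x)).hasFDerivAt.comp x hFx.hasFDerivAt
    have hd := hηx.hasFDerivAt.mul hUF
    have e : lineDeriv ℝ (fun x => η x * (U ∘ F) x) x v = _ := (hd.hasLineDerivAt v).lineDeriv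
    rw [e, extGrad, inner_add_left, real_inner_smul_left, real_inner_smul_left,
      ContinuousLinearMap.adjoint_inner_left, inner_gradient_left, inner_gradient_left, mul_comm]
    simp
  have e2 : ∫ x, lineDeriv ℝ φ x (-v) * (η x * (U ∘ F) x)
      = -∫ x, extFun F η U x * fderiv ℝ φ x v := by
    rw [← integral_neg]
    refine integral_congr_ae (Eventually.of_forall fun x => ?_)
    simp only [(hφ.differentiable one_ne_zero x).lineDeriv_eq_fderiv, map_neg, extFun,
      Function.comp_apply]
    ring
  rw [e1, e2] at key
  rw [key, neg_neg]

omit h in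
theorem eLpNorm_le_mul_eLpNorm_restrict {α V V' : Type*} [MeasurableSpace α] {μ : Measure α}
    [NormedAddCommGroup V] [NormedAddCommGroup V'] {s : Set α} (hs : MeasurableSet s)
    {k : α → V} {f : α → V'} {C : ℝ} (hk : ∀ x ∈ s, ‖k x‖ ≤ C * ‖f x‖) (hk0 : ∀ x ∉ s, k x = 0)
    (p : ℝ≥0∞) : eLpNorm k p μ ≤ ENNReal.ofReal C * eLpNorm f p (μ.restrict s) := by
  rw [← eLpNorm_indicator_eq_eLpNorm_restrict hs]
  refine eLpNorm_le_mul_eLpNorm_of_ae_le_mul (Eventually.of_forall fun x => ?_) p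
  by_cases hx : x ∈ s
  · rw [indicator_of_mem hx]; exact hk x hx
  · rw [indicator_of_notMem hx, hk0 x hx]; simp

/-- The extension of a function with a weak gradient on `Ω` has the expected weak gradient on the
whole space: this holds for smooth functions and passes to the limit in `L¹`. -/
theorem hasWeakGradient_univ (hw : HasWeakGradient Ω u g) (hΩ : IsOpen Ω) (hc : Convex ℝ Ω)
    (hu : ∀ R, IntegrableOn u (Ω ∩ ball 0 R)) (hg : ∀ R, IntegrableOn g (Ω ∩ ball 0 R)) :
    HasWeakGradient univ (extFun F η u) (extGrad F η u g) := by
  have hum := hw.locallyIntegrableOn.aestronglyMeasurable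
  have hgm := hw.locallyIntegrableOn_grad.aestronglyMeasurable
  have hli := h.locallyIntegrable_extFun hum hu
  have hlg := h.locallyIntegrable_extGrad hum hgm hu hg
  refine ⟨hli.locallyIntegrableOn _, hlg.locallyIntegrableOn _, fun φ hφ hφc _ v => ?_⟩
  simp only [Measure.restrict_univ]
  have hφ1 : ContDiff ℝ 1 φ := hφ.of_le (by exact_mod_cast le_top)
  obtain ⟨R, hR⟩ := hφc.isBounded.subset_ball (0 : EuclideanSpace ℝ (Fin N))
  set S := Ω ∩ ball 0 (‖F 0‖ + L * R + 1) with hS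
  have hSo : IsOpen S := hΩ.inter isOpen_ball
  obtain ⟨U, hU, hUc, hUu, hUg⟩ := (hw.mono inter_subset_left).exists_tendsto hSo
    (hc.inter (convex_ball _ _)) (isBounded_ball.subset inter_subset_right) (hu _) (hg _)
  have hUcont : ∀ n, Continuous (U n) := fun n => (hU n).continuous
  have hUgcont : ∀ n, Continuous (gradient (U n)) := fun n =>
    (LinearIsometryEquiv.continuous _).comp ((hU n).continuous_fderiv one_ne_zero)
  have hlin : ∀ n, LocallyIntegrable (extFun F η (U n)) := fun n =>
    h.locallyIntegrable_extFun (hUcont n).aestronglyMeasurable fun R =>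
      ((hUcont n).locallyIntegrable.integrableOn_isCompact (isCompact_closedBall 0 R)).mono_set
        (inter_subset_right.trans ball_subset_closedBall)
  have hlgn : ∀ n, LocallyIntegrable (extGrad F η (U n) (gradient (U n))) := fun n =>
    h.locallyIntegrable_extGrad (hUcont n).aestronglyMeasurable
      (hUgcont n).aestronglyMeasurable
      (fun R => ((hUcont n).locallyIntegrable.integrableOn_isCompact
        (isCompact_closedBall 0 R)).mono_set (inter_subset_right.trans ball_subset_closedBall))
      fun R => ((hUgcont n).locallyIntegrable.integrableOn_isCompact
        (isCompact_closedBall 0 R)).mono_set (inter_subset_right.trans ball_subset_closedBall)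
  have hdc : Continuous fun x => fderiv ℝ φ x v :=
    (hφ1.continuous_fderiv one_ne_zero).clm_apply continuous_const
  have hds : HasCompactSupport fun x => fderiv ℝ φ x v := hφc.fderiv_apply ℝ v
  have hint1 : ∀ {f : EuclideanSpace ℝ (Fin N) → ℝ}, LocallyIntegrable f →
      Integrable fun x => f x * fderiv ℝ φ x v := fun hf =>
    hf.integrable_smul_right_of_hasCompactSupport hdc hds
  have hint2 : ∀ {f : EuclideanSpace ℝ (Fin N) → EuclideanSpace ℝ (Fin N)},
      LocallyIntegrable f → Integrable fun x => φ x * ⟪f x, v⟫ := fun hf => by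
    have := (hf.integrable_smul_left_of_hasCompactSupport hφ.continuous hφc).inner_const (𝕜 := ℝ) v
    simpa only [real_inner_smul_left] using this
  obtain ⟨C₁, hC₁⟩ := hdc.bounded_above_of_compact_support hds
  obtain ⟨C₂, hC₂⟩ := hφ.continuous.bounded_above_of_compact_support hφc
  have hφ0 : ∀ x ∉ ball (0 : EuclideanSpace ℝ (Fin N)) R, φ x = 0 := fun x hx => by
    by_contra h0; exact hx (hR (subset_tsupport _ h0))
  have hdφ0 : ∀ x ∉ ball (0 : EuclideanSpace ℝ (Fin N)) R, fderiv ℝ φ x v = 0 := fun x hx => by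
    have : fderiv ℝ φ x = 0 := by
      by_contra h0; exact hx (hR (support_fderiv_subset ℝ h0))
    simp [this]
  have humS : AEStronglyMeasurable u (volume.restrict S) := (hu _).aestronglyMeasurable
  have hgmS : AEStronglyMeasurable g (volume.restrict S) := (hg _).aestronglyMeasurable
  have hlim1 : Tendsto (fun n => ∫ x, extFun F η (U n) x * fderiv ℝ φ x v) atTop
      (𝓝 (∫ x, extFun F η u x * fderiv ℝ φ x v)) := by
    refine tendsto_integral_of_L1' _ (hint1 hli).aestronglyMeasurable
      (Eventually.of_forall fun n => hint1 (hlin n)) ?_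
    refine tendsto_of_tendsto_of_tendsto_of_le_of_le tendsto_const_nhds
      (h := fun n => ENNReal.ofReal C₁ * (M * eLpNorm (U n - u) 1 (volume.restrict S)))
      ?_ (fun _ => bot_le) fun n => ?_
    · have := ENNReal.Tendsto.const_mul (ENNReal.Tendsto.const_mul hUu (Or.inr h.ne_top))
        (Or.inr (ENNReal.ofReal_ne_top (r := C₁)))
      simpa using this
    · refine (eLpNorm_le_mul_eLpNorm_restrict (f := extFun F η (U n - u)) (C := C₁)
        measurableSet_ball (fun x _ => ?_) (fun x hx => ?_) 1).trans
        (mul_le_mul_right (h.eLpNorm_extFun_restrict_ball_le R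
          ((hUcont n).aestronglyMeasurable.sub humS)) _)
      · rw [← extFun_sub, Pi.sub_apply, Pi.sub_apply, ← sub_mul, norm_mul, mul_comm]
        exact mul_le_mul_of_nonneg_right (hC₁ x) (norm_nonneg _)
      · simp [hdφ0 x hx]
  have hlim2 : Tendsto (fun n => ∫ x, φ x * ⟪extGrad F η (U n) (gradient (U n)) x, v⟫) atTop
      (𝓝 (∫ x, φ x * ⟪extGrad F η u g x, v⟫)) := by
    refine tendsto_integral_of_L1' _ (hint2 hlg).aestronglyMeasurable
      (Eventually.of_forall fun n => hint2 (hlgn n)) ?_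
    refine tendsto_of_tendsto_of_tendsto_of_le_of_le tendsto_const_nhds
      (h := fun n => ENNReal.ofReal (C₂ * ‖v‖) *
        (L * (M * eLpNorm (gradient (U n) - g) 1 (volume.restrict S))
          + L' * (M * eLpNorm (U n - u) 1 (volume.restrict S))))
      ?_ (fun _ => bot_le) fun n => ?_
    · have h1 := ENNReal.Tendsto.const_mul (ENNReal.Tendsto.const_mul hUu (Or.inr h.ne_top))
        (Or.inr (ENNReal.coe_ne_top (r := L')))
      have h2 := ENNReal.Tendsto.const_mul (ENNReal.Tendsto.const_mul hUg (Or.inr h.ne_top))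
        (Or.inr (ENNReal.coe_ne_top (r := L)))
      have := ENNReal.Tendsto.const_mul (h2.add h1)
        (Or.inr (ENNReal.ofReal_ne_top (r := C₂ * ‖v‖)))
      simpa using this
    · refine (eLpNorm_le_mul_eLpNorm_restrict (f := extGrad F η (U n - u) (gradient (U n) - g))
        (C := C₂ * ‖v‖) measurableSet_ball (fun x _ => ?_) (fun x hx => ?_) 1).trans
        (mul_le_mul_right (h.eLpNorm_extGrad_restrict_ball_le R
          ((hUcont n).aestronglyMeasurable.sub humS)
          ((hUgcont n).aestronglyMeasurable.sub hgmS)) _)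
      · rw [← extGrad_sub, Pi.sub_apply, Pi.sub_apply, ← mul_sub, ← inner_sub_left, norm_mul]
        refine (mul_le_mul (hC₂ x) (norm_inner_le_norm _ _) (norm_nonneg _)
          ((norm_nonneg _).trans (hC₂ x))).trans_eq ?_
        ring
      · simp [hφ0 x hx]
  refine tendsto_nhds_unique hlim1 ?_
  simp only [h.integral_extFun_of_contDiff (hU _) (hUc _) hφ1 hφc v]
  exact hlim2.neg

end ExtensionData

end Extension

/-! ### The reflection extends functions from the domain -/

section Domain

variable {N : ℕ} {Ω : Set (EuclideanSpace ℝ (Fin N))} {r : ℝ}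

theorem volume_image_le_of_lipschitzWith
    {f : EuclideanSpace ℝ (Fin N) → EuclideanSpace ℝ (Fin N)} {C : ℝ≥0} (hf : LipschitzWith C f)
    (s : Set (EuclideanSpace ℝ (Fin N))) : volume (f '' s) ≤ (C : ℝ≥0∞) ^ N * volume s := by
  have h := hf.hausdorffMeasure_image_le (d := N) (Nat.cast_nonneg N) s
  rw [ENNReal.rpow_natCast] at h
  rw [← EuclideanSpace.euclideanHausdorffMeasure_eq_volume,
    Measure.euclideanHausdorffMeasure_def, Measure.smul_apply, Measure.smul_apply, ENNReal.smul_def,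
    ENNReal.smul_def, smul_eq_mul, smul_eq_mul, mul_left_comm]
  exact mul_le_mul_right h _

/-- The points at distance less than `3 r / 2` from the core, off the boundary of the domain. -/
def collar (Ω : Set (EuclideanSpace ℝ (Fin N))) (r : ℝ) : Set (EuclideanSpace ℝ (Fin N)) :=
  {x | ‖residual (core Ω r) x‖ < 3 * r / 2 ∧ ‖residual (core Ω r) x‖ ≠ r}

variable (h : InteriorSphereCondition Ω r) (hr : 0 < r) (ho : IsOpen Ω) (hc : Convex ℝ Ω)
  (hne : Ω.Nonempty)
include h hr ho hc hne

theorem norm_residual_core_le_of_mem_closure {x : EuclideanSpace ℝ (Fin N)}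
    (hx : x ∈ closure Ω) : ‖residual (core Ω r) x‖ ≤ r := by
  have hK := h.isProjectable_core hr ho hc hne
  have e : Ω = {x | ‖residual (core Ω r) x‖ < r} := by
    ext x; exact h.mem_iff hr ho hc hne x
  rw [e] at hx
  exact closure_lt_subset_le hK.lipschitzWith_residual.continuous.norm continuous_const hx

theorem mem_frontier_of_norm_residual_core_eq {x : EuclideanSpace ℝ (Fin N)}
    (hx : ‖residual (core Ω r) x‖ = r) : x ∈ frontier Ω := by
  have hK := h.isProjectable_core hr ho hc hne
  rw [ho.frontier_eq]
  refine ⟨?_, fun hxΩ => ((h.mem_iff hr ho hc hne x).1 hxΩ).ne hx⟩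
  rw [Metric.mem_closure_iff]
  intro ε hε
  set m := max 0 (1 - ε / (2 * r)) with hm
  have hm0 : 0 ≤ m := le_max_left _ _
  have hm1 : m < 1 := max_lt one_pos (by have : 0 < ε / (2 * r) := by positivity
                                         linarith)
  refine ⟨metricProj (core Ω r) x + m • residual (core Ω r) x, ?_, ?_⟩
  · rw [h.mem_iff hr ho hc hne, hK.residual_add_smul_residual x hm0, norm_smul, hx,
      Real.norm_of_nonneg hm0]
    nlinarith
  · nth_rw 1 [← metricProj_add_residual (core Ω r) x]
    have e : metricProj (core Ω r) x + residual (core Ω r) x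
        - (metricProj (core Ω r) x + m • residual (core Ω r) x)
        = (1 - m) • residual (core Ω r) x := by rw [sub_smul, one_smul]; abel
    rw [dist_eq_norm, e, norm_smul, hx, Real.norm_of_nonneg (by linarith)]
    have h1 : 1 - ε / (2 * r) ≤ m := le_max_right _ _
    have h2 : (1 - m) * r ≤ ε / (2 * r) * r := mul_le_mul_of_nonneg_right (by linarith) hr.le
    have h3 : ε / (2 * r) * r = ε / 2 := by field_simp
    linarith

theorem map_reflection_le :
    (volume.restrict (collar Ω r)).map (reflection (core Ω r) r)
      ≤ (1 + 7 ^ N : ℝ≥0∞) • volume.restrict Ω := by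
  have hK := h.isProjectable_core hr ho hc hne
  have hF := (lipschitzWith_reflection hK hr).continuous.measurable
  refine Measure.le_iff.2 fun T hT => ?_
  have hsub : reflection (core Ω r) r ⁻¹' T ∩ collar Ω r
      ⊆ (T ∩ Ω) ∪ reflectionInv (core Ω r) r '' (T ∩ Ω) := by
    rintro x ⟨hxT, hx1, hx2⟩
    rcases lt_or_gt_of_ne hx2 with hlt | hgt
    -- inside `Ω` the map is the identity; outside, `x` is recovered from its reflection
    · left
      rw [mem_preimage, reflection_of_le hlt.le] at hxT
      exact ⟨hxT, (h.mem_iff hr ho hc hne x).2 hlt⟩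
    · refine Or.inr ⟨reflection (core Ω r) r x, ⟨hxT, (h.mem_iff hr ho hc hne _).2 ?_⟩,
        reflectionInv_reflection hK hr hgt.le hx1.le⟩
      rw [(residual_reflection hK hr hgt.le hx1.le).2]
      linarith
  rw [Measure.map_apply hF hT, Measure.restrict_apply (hF hT), Measure.smul_apply,
    Measure.restrict_apply hT, smul_eq_mul, add_mul, one_mul]
  refine (measure_mono hsub).trans ((measure_union_le _ _).trans ?_)
  gcongr
  exact volume_image_le_of_lipschitzWith (lipschitzWith_reflectionInv hK hr) _

theorem extensionData_reflection :
    ExtensionData Ω (collar Ω r) (reflection (core Ω r) r) (cutoff (core Ω r) r) 5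
      (Real.toNNReal (2 / r)) (1 + 7 ^ N) where
  lipschitz_map := lipschitzWith_reflection (h.isProjectable_core hr ho hc hne) hr
  lipschitz_cutoff := lipschitzWith_cutoff (h.isProjectable_core hr ho hc hne) hr
  cutoff_nonneg := cutoff_nonneg
  cutoff_le_one := cutoff_le_one
  measurableSet := by
    have := (h.isProjectable_core hr ho hc hne).lipschitzWith_residual.continuous.norm.measurable
    exact (measurableSet_lt this measurable_const).inter
      (measurableSet_eq_fun this measurable_const).compl
  map_le := map_reflection_le h hr ho hc hne
  ne_top := by simp
  ae_eq_zero := by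
    filter_upwards [measure_eq_zero_iff_ae_notMem.1 (hc.addHaar_frontier volume)] with x hx hxW
    refine cutoff_eq_zero hr (not_lt.1 fun hlt => hxW ⟨hlt, fun he => hx ?_⟩)
    exact mem_frontier_of_norm_residual_core_eq h hr ho hc hne he

end Domain

/-! ### Gaussian weights -/

section Gaussian

theorem map_withDensity_restrict_le {α : Type*} [MeasurableSpace α] {μ : Measure α} {F : α → α}
    (hF : Measurable F) {W Ω : Set α} (hW : MeasurableSet W) {M c : ℝ≥0∞}
    (h : (μ.restrict W).map F ≤ M • μ.restrict Ω) {w : α → ℝ≥0∞} (hw : Measurable w)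
    (hwF : ∀ x ∈ W, w x ≤ c * w (F x)) :
    ((μ.withDensity w).restrict W).map F ≤ (c * M) • (μ.withDensity w).restrict Ω := by
  refine Measure.le_iff.2 fun T hT => ?_
  rw [Measure.map_apply hF hT, restrict_withDensity hW, withDensity_apply _ (hF hT),
    Measure.smul_apply, smul_eq_mul]
  calc ∫⁻ x in F ⁻¹' T, w x ∂μ.restrict W
      ≤ ∫⁻ x in F ⁻¹' T, c * w (F x) ∂μ.restrict W :=
        lintegral_mono_ae (ae_restrict_of_ae ((ae_restrict_mem hW).mono hwF))
    _ = c * ∫⁻ x in T, w x ∂(μ.restrict W).map F := by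
        rw [lintegral_const_mul c (f := fun x => w (F x)) (hw.comp hF), setLIntegral_map hT hw hF]
    _ ≤ c * ∫⁻ x in T, w x ∂(M • μ.restrict Ω) := by
        gcongr
    _ = c * M * ∫⁻ x in T, w x ∂μ.restrict Ω := by
        rw [Measure.restrict_smul, lintegral_smul_measure, smul_eq_mul, mul_assoc]
    _ ≤ c * M * (μ.withDensity w).restrict Ω T := by
        gcongr
        rw [Measure.restrict_restrict hT, Measure.restrict_apply hT]
        exact withDensity_apply_le _ _

variable {N : ℕ}

/-- The density of the Gaussian measure. -/
def gaussianDensity (N : ℕ) (x : EuclideanSpace ℝ (Fin N)) : ℝ :=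
  1 / (2 * Real.pi) ^ ((N : ℝ) / 2) * Real.exp (-‖x‖ ^ 2 / 2)

theorem measurable_gaussianDensity : Measurable (gaussianDensity N) := by
  unfold gaussianDensity
  fun_prop

theorem gaussianDensity_le {x y : EuclideanSpace ℝ (Fin N)} {b : ℝ}
    (h : ‖y‖ ^ 2 ≤ ‖x‖ ^ 2 + 2 * b) :
    ENNReal.ofReal (gaussianDensity N x)
      ≤ ENNReal.ofReal (Real.exp b) * ENNReal.ofReal (gaussianDensity N y) := by
  rw [← ENNReal.ofReal_mul (Real.exp_nonneg _)]
  refine ENNReal.ofReal_le_ofReal ?_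
  rw [gaussianDensity, gaussianDensity, mul_left_comm, ← Real.exp_add]
  gcongr
  linarith

theorem volume_restrict_inter_ball_le (Ω : Set (EuclideanSpace ℝ (Fin N))) (R : ℝ) :
    volume.restrict (Ω ∩ ball 0 R)
      ≤ ENNReal.ofReal (Real.exp (R ^ 2 / 2) * (2 * Real.pi) ^ ((N : ℝ) / 2)) •
        (gaussianMeasure N).restrict Ω := by
  set c := Real.exp (R ^ 2 / 2) * (2 * Real.pi) ^ ((N : ℝ) / 2) with hc
  have hpt : ∀ x ∈ ball (0 : EuclideanSpace ℝ (Fin N)) R,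
      1 ≤ ENNReal.ofReal c * ENNReal.ofReal (gaussianDensity N x) := by
    intro x hx
    rw [mem_ball_zero_iff] at hx
    have h1 : 0 < (2 * Real.pi) ^ ((N : ℝ) / 2) := by positivity
    have h2 : c * gaussianDensity N x = Real.exp (R ^ 2 / 2 + -‖x‖ ^ 2 / 2) := by
      rw [hc, gaussianDensity, Real.exp_add]
      field_simp
    rw [← ENNReal.ofReal_mul (by positivity), h2, ENNReal.one_le_ofReal]
    refine Real.one_le_exp ?_
    nlinarith [norm_nonneg x]
  refine Measure.le_iff.2 fun T hT => ?_
  rw [Measure.restrict_apply hT, Measure.smul_apply, Measure.restrict_apply hT, smul_eq_mul]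
  calc volume (T ∩ (Ω ∩ ball 0 R))
      = ∫⁻ _ in T ∩ (Ω ∩ ball 0 R), 1 := (setLIntegral_one _).symm
    _ ≤ ∫⁻ x in T ∩ (Ω ∩ ball 0 R), ENNReal.ofReal c * ENNReal.ofReal (gaussianDensity N x) :=
        lintegral_mono_ae (ae_restrict_of_ae_restrict_of_subset
          (inter_subset_right.trans inter_subset_right)
          ((ae_restrict_mem measurableSet_ball).mono hpt))
    _ = ENNReal.ofReal c * ∫⁻ x in T ∩ (Ω ∩ ball 0 R), ENNReal.ofReal (gaussianDensity N x) :=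
        lintegral_const_mul _ measurable_gaussianDensity.ennreal_ofReal
    _ ≤ ENNReal.ofReal c * gaussianMeasure N (T ∩ Ω) := by
        gcongr
        exact (withDensity_apply_le _ _).trans
          (measure_mono (inter_subset_inter_right T inter_subset_left))

theorem gaussianMeasure_absolutelyContinuous : gaussianMeasure N ≪ volume :=
  withDensity_absolutelyContinuous _ _

end Gaussian

/-! ### The extension theorem -/

section Main

variable {N : ℕ}

theorem integrableOn_inter_ball_of_memLp_gaussianMeasure {V : Type*} [NormedAddCommGroup V]
    {Ω : Set (EuclideanSpace ℝ (Fin N))} {f : EuclideanSpace ℝ (Fin N) → V}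
    (hf : MemLp f 2 ((gaussianMeasure N).restrict Ω)) (R : ℝ) :
    IntegrableOn f (Ω ∩ ball 0 R) := by
  have h1 := hf.of_measure_le_smul ENNReal.ofReal_ne_top (volume_restrict_inter_ball_le Ω R)
  have : IsFiniteMeasure (volume.restrict (Ω ∩ ball (0 : EuclideanSpace ℝ (Fin N)) R)) :=
    ⟨by rw [Measure.restrict_apply_univ]
        exact (measure_mono inter_subset_right).trans_lt measure_ball_lt_top⟩
  exact h1.integrable one_le_two

/-- The extension constant depends only on `N`, `r` and the distance of the domain from the origin:
the weight at a point of the collar is controlled by the weight at its reflection. -/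
theorem exists_extension (N : ℕ) {r : ℝ} (hr : 0 < r) (D : ℝ) :
    ∃ C : ℝ, 0 < C ∧ ∀ Ω : Set (EuclideanSpace ℝ (Fin N)), IsOpen Ω → Convex ℝ Ω →
      InteriorSphereCondition Ω r → (∃ p ∈ closure Ω, ‖p‖ ≤ D) →
      ∀ u : EuclideanSpace ℝ (Fin N) → ℝ, MemH1 Ω u →
        ∃ u' : EuclideanSpace ℝ (Fin N) → ℝ, MemH1 univ u' ∧ EqOn u' u Ω ∧
          h1Norm univ u' ≤ C * h1Norm Ω u := by
  set B : ℝ≥0∞ := (ENNReal.ofReal (Real.exp (r * D)) * (1 + 7 ^ N)) ^ (1 / (2 : ℝ≥0∞)).toReal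
    with hB
  have hBt : B ≠ ⊤ := ENNReal.rpow_ne_top_of_nonneg ENNReal.toReal_nonneg
    (ENNReal.mul_ne_top ENNReal.ofReal_ne_top (by simp))
  set L' : ℝ≥0 := Real.toNNReal (2 / r) with hL'
  refine ⟨B.toReal * (1 + 5 + L') + 1, by positivity, ?_⟩
  rintro Ω ho hc h ⟨p, hp, hpD⟩ u ⟨⟨g₀, hg₀⟩, huL, hgL⟩
  have hne : Ω.Nonempty := closure_nonempty_iff.1 ⟨p, hp⟩
  have hK := h.isProjectable_core hr ho hc hne
  have hE := extensionData_reflection h hr ho hc hne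
  set F := reflection (core Ω r) r with hF
  set η := cutoff (core Ω r) r with hη
  set g := weakGradient Ω u with hg
  have hw : HasWeakGradient Ω u g := by
    have hex : ∃ g, HasWeakGradient Ω u g := ⟨g₀, hg₀⟩
    rw [hg, weakGradient, dif_pos hex]
    exact hex.choose_spec
  have hFm := hE.lipschitz_map.continuous.measurable
  have hmap : ((gaussianMeasure N).restrict (collar Ω r)).map F
      ≤ (ENNReal.ofReal (Real.exp (r * D)) * (1 + 7 ^ N)) • (gaussianMeasure N).restrict Ω := by
    refine map_withDensity_restrict_le hFm hE.measurableSet hE.map_le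
      measurable_gaussianDensity.ennreal_ofReal fun x hx => gaussianDensity_le ?_
    have h1 := norm_sq_reflection_le hK hr
      (norm_residual_core_le_of_mem_closure h hr ho hc hne hp) hx.1.le
    have h2 : r * ‖p‖ ≤ r * D := mul_le_mul_of_nonneg_left hpD hr.le
    linarith
  have hwu := hE.hasWeakGradient_univ hw ho hc (integrableOn_inter_ball_of_memLp_gaussianMeasure huL)
    (integrableOn_inter_ball_of_memLp_gaussianMeasure hgL)
  have hac : (gaussianMeasure N).restrict univ ≪ volume := by
    rw [Measure.restrict_univ]; exact gaussianMeasure_absolutelyContinuous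
  have hgrad : weakGradient univ (extFun F η u) =ᵐ[(gaussianMeasure N).restrict univ]
      extGrad F η u g := by
    have := hwu.weakGradient_ae_eq isOpen_univ
    rw [Measure.restrict_univ] at this
    exact hac.ae_eq this
  have hu2 : eLpNorm (u ∘ F) 2 ((gaussianMeasure N).restrict (collar Ω r))
      ≤ B * eLpNorm u 2 ((gaussianMeasure N).restrict Ω) :=
    eLpNorm_comp_le_of_map_le hFm hmap huL.1 ENNReal.ofNat_ne_top
  have hg2 : eLpNorm (g ∘ F) 2 ((gaussianMeasure N).restrict (collar Ω r))
      ≤ B * eLpNorm g 2 ((gaussianMeasure N).restrict Ω) :=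
    eLpNorm_comp_le_of_map_le hFm hmap hgL.1 ENNReal.ofNat_ne_top
  have hbu : eLpNorm (extFun F η u) 2 ((gaussianMeasure N).restrict univ)
      ≤ B * eLpNorm u 2 ((gaussianMeasure N).restrict Ω) := by
    rw [Measure.restrict_univ]
    exact (hE.eLpNorm_extFun_le gaussianMeasure_absolutelyContinuous 2 u).trans hu2
  have hbg : eLpNorm (weakGradient univ (extFun F η u)) 2 ((gaussianMeasure N).restrict univ)
      ≤ 5 * (B * eLpNorm g 2 ((gaussianMeasure N).restrict Ω))
        + L' * (B * eLpNorm u 2 ((gaussianMeasure N).restrict Ω)) := by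
    rw [eLpNorm_congr_ae hgrad, Measure.restrict_univ]
    refine (hE.eLpNorm_extGrad_le gaussianMeasure_absolutelyContinuous one_le_two
      (aestronglyMeasurable_comp_of_map_le hFm hmap huL.1)
      (aestronglyMeasurable_comp_of_map_le hFm hmap hgL.1)).trans ?_
    gcongr
    norm_num
  have hum := hw.locallyIntegrableOn.aestronglyMeasurable
  have hgm := hw.locallyIntegrableOn_grad.aestronglyMeasurable
  have hBu : B * eLpNorm u 2 ((gaussianMeasure N).restrict Ω) ≠ ⊤ :=
    ENNReal.mul_ne_top hBt huL.2.ne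
  have hBg : B * eLpNorm g 2 ((gaussianMeasure N).restrict Ω) ≠ ⊤ :=
    ENNReal.mul_ne_top hBt hgL.2.ne
  have hfin : 5 * (B * eLpNorm g 2 ((gaussianMeasure N).restrict Ω))
      + L' * (B * eLpNorm u 2 ((gaussianMeasure N).restrict Ω)) ≠ ⊤ :=
    ENNReal.add_ne_top.2 ⟨ENNReal.mul_ne_top ENNReal.ofNat_ne_top hBg,
      ENNReal.mul_ne_top ENNReal.coe_ne_top hBu⟩
  refine ⟨extFun F η u, ⟨⟨_, hwu⟩, ⟨?_, hbu.trans_lt hBu.lt_top⟩, ?_, hbg.trans_lt hfin.lt_top⟩,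
    fun x hx => ?_, ?_⟩
  · exact (hE.aestronglyMeasurable_extFun hum).mono_ac hac
  · exact ((hE.aestronglyMeasurable_extGrad hum hgm).mono_ac hac).congr hgrad.symm
  · have hx' := ((h.mem_iff hr ho hc hne x).1 hx).le
    rw [extFun, hη, cutoff_eq_one hr hx', hF, reflection_of_le hx', one_mul]
  · have r1 := ENNReal.toReal_mono hBu hbu
    have r2 := ENNReal.toReal_mono hfin hbg
    rw [ENNReal.toReal_add (ENNReal.mul_ne_top ENNReal.ofNat_ne_top hBg)
      (ENNReal.mul_ne_top ENNReal.coe_ne_top hBu)] at r2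
    simp only [ENNReal.toReal_mul, ENNReal.toReal_ofNat, ENNReal.coe_toReal] at r1 r2
    rw [h1Norm, h1Norm, ← hg]
    have n1 := ENNReal.toReal_nonneg (a := eLpNorm u 2 ((gaussianMeasure N).restrict Ω))
    have n2 := ENNReal.toReal_nonneg (a := eLpNorm g 2 ((gaussianMeasure N).restrict Ω))
    have n3 := ENNReal.toReal_nonneg (a := B)
    have n4 : (0 : ℝ) ≤ L' := L'.2
    have n5 := mul_nonneg n3 n1
    have n6 := mul_nonneg n3 n2
    have n7 := mul_nonneg n4 n6
    nlinarith

end Main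

end

end GaussExt

theorem theorem2p1 (N : ℕ) (hN : 2 ≤ N) (r : ℝ) (hr : 0 < r) :
    (∃ C : ℝ, 0 < C ∧ ∀ Ω : Set (EuclideanSpace ℝ (Fin N)),
      GaussExt.IsC2Domain Ω → Convex ℝ Ω → GaussExt.InteriorSphereCondition Ω r → 0 ∈ Ω →
      ∀ u : EuclideanSpace ℝ (Fin N) → ℝ, GaussExt.MemH1 Ω u →
        ∃ u' : EuclideanSpace ℝ (Fin N) → ℝ, GaussExt.MemH1 univ u' ∧ EqOn u' u Ω ∧
          GaussExt.h1Norm univ u' ≤ C * GaussExt.h1Norm Ω u) ∧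
    (∀ d₀ : ℝ, ∃ C : ℝ, 0 < C ∧ ∀ Ω : Set (EuclideanSpace ℝ (Fin N)),
      GaussExt.IsC2Domain Ω → Convex ℝ Ω → GaussExt.InteriorSphereCondition Ω r → 0 ∉ Ω →
      infDist 0 (frontier Ω) = d₀ →
      ∀ u : EuclideanSpace ℝ (Fin N) → ℝ, GaussExt.MemH1 Ω u →
        ∃ u' : EuclideanSpace ℝ (Fin N) → ℝ, GaussExt.MemH1 univ u' ∧ EqOn u' u Ω ∧
          GaussExt.h1Norm univ u' ≤ C * GaussExt.h1Norm Ω u) := by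
  refine ⟨?_, fun d₀ => ?_⟩
  · obtain ⟨C, hC, h⟩ := GaussExt.exists_extension N hr 0
    exact ⟨C, hC, fun Ω hΩ hc hs h0 =>
      h Ω hΩ.isOpen hc hs ⟨0, subset_closure h0, norm_zero.le⟩⟩
  · -- a boundary point nearest to the origin has norm `d₀`
    obtain ⟨C, hC, h⟩ := GaussExt.exists_extension N hr d₀
    refine ⟨C, hC, fun Ω hΩ hc hs h0 hd => h Ω hΩ.isOpen hc hs ?_⟩
    have hne : (frontier Ω).Nonempty :=
      nonempty_frontier_iff.2 ⟨hΩ.isConnected.nonempty, fun h => h0 (h ▸ mem_univ _)⟩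
    obtain ⟨p, hp, hpd⟩ := isClosed_frontier.exists_infDist_eq_dist hne 0
    refine ⟨p, frontier_subset_closure hp, ?_⟩
    rw [← hd, hpd, dist_zero_left]
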